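/- Let $0<q<1$, $\gamma,c\in\mathbb R$ with $\gamma\neq 0$, and $n\ge 0$. Put $[\gamma]_q=\frac{q^{\gamma}-q^{-\gamma}}{q-q^{-1}}$ and fix the principal complex square root $[\gamma]_q^{1/2}$. Let $\mathbf H=\mathbf H^{(\gamma,c)}$ be the complex vector space with basis $h_m$ ($m\ge 0$) and the operators $$\alpha^-h_m=[\gamma]_q^{1/2}m^{1/2}h_{m-1},\quad \alpha^+h_m=[\gamma]_q^{1/2}(m+1)^{1/2}h_{m+1},\quad \epsilon h_m=(m+c)h_m,\quad \Gamma h_m=\gamma h_m .$$ On $\mathbf H\otimes\mathbf H$ put $$\Re=q^{-(\epsilon\otimes\Gamma+\Gamma\otimes\epsilon)}\exp\big[(q-q^{-1})(q^{\Gamma/2}\otimes q^{-\Gamma/2})(\alpha^-\otimes\alpha^+)\big],\qquad \mathcal O=q^{-\Gamma/2}[\Gamma]_q^{-1/2}\alpha^+\otimes[\Gamma]_q^{1/2}-[\Gamma]_q^{1/2}\otimes q^{\Gamma/2}[\Gamma]_q^{-1/2}\alpha^+ ,$$ and let $\mathcal P$ be the flip. On $\mathbf H^{\otimes n}$ let $\sigma_i$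 be $q^{2c\gamma}\,\mathcal P\Re$ in the positions $i,i+1$, let $\mathcal O_i$ be $\mathcal O$ in the positions $i,i+1$ ($1\le i\le n-1$), let $v_0=h_0\otimes\cdots\otimes h_0$ and $w_{i,j}=\mathcal O_i\mathcal O_jv_0$. Let $\mathbf V$ be the space of all $x\in\mathbf H^{\otimes n}$ with $\Delta^{(n)}\epsilon\, x=(nc+2)x$ and $\Delta^{(n)}\alpha^- x=0$, where $\Delta^{(n)}\epsilon=\sum_k 1^{\otimes k-1}\otimes\epsilon\otimes 1^{\otimes n-k}$ and $\Delta^{(n)}\alpha^-=\sum_k (q^{-\Gamma/2})^{\otimes k-1}\otimes\alpha^-\otimes(q^{\Gamma/2})^{\otimes n-k}$. (a) The operators $\sigma_i$ preserve $\mathbf V$ and define a representation of the braid group $B_n$ on $\mathbf V$. One has $w_{i,j}=w_{j,i}$, the vectors $w_{i,j}$ with $1\le i\le j\le n-1$ form a basis of $\mathbf V$, and $\dim\mathbf V=n(n-1)/2$. (b) Whenever all indices lie in $\{1,\dots,n-1\}$ and $j,k\notin\{i-1,i,i+1\}$, \begin{align*} \sigma_i w_{j,k}&=w_{j,k}, &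 \sigma_i w_{i,i}&=q^{-4\gamma}w_{i,i},\\ \sigma_i w_{i,k}&=-q^{-2\gamma}w_{i,k}, & \sigma_i w_{k,i}&=-q^{-2\gamma}w_{k,i},\\ \sigma_i w_{i\pm1,k}&=q^{-\gamma}w_{i,k}+w_{i\pm1,k}, & \sigma_i w_{k,i\pm1}&=q^{-\gamma}w_{k,i}+w_{k,i\pm1},\\ \sigma_i w_{i-1,i}&=-q^{-2\gamma}(w_{i-1,i}+q^{-\gamma}w_{i,i}), & \sigma_i w_{i,i+1}&=-q^{-2\gamma}(w_{i,i+1}+q^{-\gamma}w_{i,i}),\\ \sigma_i w_{i-1,i-1}&=q^{-2\gamma}w_{i,i}+2q^{-\gamma}w_{i-1,i}+w_{i-1,i-1}, & \sigma_i w_{i+1,i+1}&=q^{-2\gamma}w_{i,i}+2q^{-\gamma}w_{i,i+1}+w_{i+1,i+1},\\ \sigma_i w_{i-1,i+1}&=q^{-2\gamma}w_{i,i}+q^{-\gamma}(w_{i-1,i}+w_{i,i+1})+w_{i-1,i+1}. \end{align*} (c) For nonzero parameters $\mathsf q,s$ let $\mathbf W_{n,2}$ be the Jackson–Kerler representation: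 with the generic Verma module of $U_{\mathsf q}(sl_2)$ with basis $v_0,v_1,\dots$, $Ev_j=v_{j-1}$ ($Ev_0=0$), $Kv_j=s\mathsf q^{-2j}v_j$, $\Delta E=E\otimes K+1\otimes E$, it is the kernel of $E$ on the span of the $v_{m_1}\otimes\cdots\otimes v_{m_n}$ with $m_1+\cdots+m_n=2$, and the $i$-th generator of $B_n$ acts in the positions $i,i+1$ by $$v_a\otimes v_b\mapsto s^{-(a+b)}\sum_{k=0}^{a}\mathsf q^{2(a-k)(b+k)+k(k-1)/2}{b+k\brack b}_{\mathsf q}\prod_{r=0}^{k-1}\big(s\mathsf q^{-r-b}-s^{-1}\mathsf q^{r+b}\big)\,v_{b+k}\otimes v_{a-k},$$ where ${b+k\brack b}_{\mathsf q}$ is the symmetric quantum binomial coefficient. Take $\mathsf q=1$ and $s=q^{\gamma}$. Then this is a representation of $B_n$, with basis $W_{i,j}=e_{i,j}-s^{i-j}e_{i,i}-s^{j-i}e_{j,j}$, $1\le i<j\le n$, where $e_{i,j}$ has $v_1$ in the positions $i,j$, $e_{i,i}$ has $v_2$ in the position $i$, and all other factors are $v_0$. There is an isomorphism $\mathbf V\to\mathbf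 W_{n,2}$ of representations of $B_n$ with \begin{align*} w_{i,i}&\mapsto-2W_{i,i+1},\\ w_{i,i+1}&\mapsto s^{-1}W_{i,i+1}-W_{i,i+2}+sW_{i+1,i+2},\\ w_{i,r}&\mapsto-W_{i,r+1}+sW_{i+1,r+1}+s^{-1}W_{i,r}-W_{i+1,r}\qquad(r\ge i+2). \end{align*} (d) $\mathbf V$ is isomorphic, as a representation of $B_n$, to the Lawrence–Krammer–Bigelow representation at the parameters $(Q,t)=(q^{-2\gamma},-1)$. Here the latter is the representation with basis $v_{j,k}$, $1\le j<k\le n$, on which the $i$-th generator acts by $$v_{j,k}\mapsto\begin{cases} v_{j,k}& i\notin\{j-1,j,k-1,k\},\\ Qv_{i,k}+(Q^2-Q)v_{i,j}+(1-Q)v_{j,k}& i=j-1,\\ v_{j+1,k}& i=j\ne k-1,\\ Qv_{j,i}+(1-Q)v_{j,k}-(Q^2-Q)t\,v_{i,k}& i=k-1\ne j,\\ v_{j,k+1}& i=k,\\ -tQ^2v_{j,k}& i=j=k-1. \end{cases}$$ -/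

import Mathlib

open scoped TensorProduct

noncomputable section

/-! ### The braid group -/

/-- The braid relations on the generators `σ_0, …, σ_{n-2}`. -/
def braidRels (n : ℕ) : Set (FreeGroup (Fin (n - 1))) :=
  {r | ∃ i j : Fin (n - 1),
      ((i : ℕ) + 1 < (j : ℕ) ∧
        r = FreeGroup.of i * FreeGroup.of j * (FreeGroup.of j * FreeGroup.of i)⁻¹) ∨
      ((i : ℕ) + 1 = (j : ℕ) ∧
        r = FreeGroup.of i * FreeGroup.of j * FreeGroup.of i *
          (FreeGroup.of j * FreeGroup.of i * FreeGroup.of j)⁻¹)}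

/-- The Artin braid group `B_n` on `n` strands. -/
abbrev BraidGroup (n : ℕ) : Type := PresentedGroup (braidRels n)

/-- The standard generators of `B_n` (counted from `0`). -/
def braidGen {n : ℕ} (i : Fin (n - 1)) : BraidGroup n := PresentedGroup.of i

/-- The left one of the two neighbouring positions on which the `i`-th generator acts. -/
def lft {n : ℕ} (i : Fin (n - 1)) : Fin n := ⟨i, by omega⟩

/-- The right one of the two neighbouring positions on which the `i`-th generator acts. -/
def rgt {n : ℕ} (i : Fin (n - 1)) : Fin n := ⟨i + 1, by omega⟩

/-! ### Tensor powers of a free module with basis `e_0, e_1, …` -/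

/-- The `n`-th tensor power of the free `K`-module with basis indexed by `ℕ`. -/
abbrev TPow (K : Type) [Field K] (n : ℕ) : Type := ⨂[K] _ : Fin n, (ℕ →₀ K)

/-- The basis `e_{m_1} ⊗ ⋯ ⊗ e_{m_n}` of the tensor power. -/
def tBasis (K : Type) [Field K] (n : ℕ) : Module.Basis (Fin n → ℕ) K (TPow K n) :=
  Basis.piTensorProduct fun _ => Finsupp.basisSingleOne

/-- `A` in position `k`, the identity elsewhere. -/
def atSite {K : Type} [Field K] {n : ℕ} (k : Fin n) (A : Module.End K (ℕ →₀ K)) :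
    Module.End K (TPow K n) :=
  PiTensorProduct.map fun j => if j = k then A else LinearMap.id

/-- `1 ⊗ ⋯ ⊗ 1 ⊗ A ⊗ B ⊗ 1 ⊗ ⋯ ⊗ 1` with `A ⊗ B` in the positions `lft i` and `rgt i`. -/
def atPair {K : Type} [Field K] {n : ℕ} (i : Fin (n - 1)) (A B : Module.End K (ℕ →₀ K)) :
    Module.End K (TPow K n) :=
  PiTensorProduct.map fun j => if j = lft i then A else if j = rgt i then B else LinearMap.id

/-- `∑_k L ⊗ ⋯ ⊗ L ⊗ A ⊗ R ⊗ ⋯ ⊗ R` with `A` in the position `k`: the `n`-fold coproduct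
of an element `a` with `Δ a = a ⊗ r + l ⊗ a`, where `r` and `l` are group-like. -/
def skewPrimitive {K : Type} [Field K] (n : ℕ) (L A R : Module.End K (ℕ →₀ K)) :
    Module.End K (TPow K n) :=
  ∑ k : Fin n, PiTensorProduct.map fun j => if j < k then L else if j = k then A else R

/-! ### The quantum oscillator algebra, its representations and its R-matrix -/

namespace HOq

/-- `[γ]_q`. -/
def qNum (q γ : ℝ) : ℝ := (q ^ γ - q ^ (-γ)) / (q - q⁻¹)

/-- `[γ]_q^{1/2}` (principal complex square root). -/
def qNumSqrt (q γ : ℝ) : ℂ := (qNum q γ : ℂ) ^ (1 / 2 : ℂ)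

/-- `α⁻` on the module `H^{(γ,c)}` with basis `h_0, h_1, …`. -/
def alphaMinus (q γ : ℝ) : Module.End ℂ (ℕ →₀ ℂ) :=
  Finsupp.linearCombination ℂ fun m : ℕ =>
    (qNumSqrt q γ * (Real.sqrt m : ℂ)) • Finsupp.single (m - 1) (1 : ℂ)

/-- `α⁺` on `H^{(γ,c)}`. -/
def alphaPlus (q γ : ℝ) : Module.End ℂ (ℕ →₀ ℂ) :=
  Finsupp.linearCombination ℂ fun m : ℕ =>
    (qNumSqrt q γ * (Real.sqrt (m + 1) : ℂ)) • Finsupp.single (m + 1) (1 : ℂ)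

/-- `ε` on `H^{(γ,c)}`. -/
def eps (c : ℝ) : Module.End ℂ (ℕ →₀ ℂ) :=
  Finsupp.linearCombination ℂ fun m : ℕ => ((m : ℂ) + (c : ℂ)) • Finsupp.single m (1 : ℂ)

/-- `Γ` on `H^{(γ,c)}`. -/
def gam (γ : ℝ) : Module.End ℂ (ℕ →₀ ℂ) := (γ : ℂ) • LinearMap.id

/-- `q^{x Γ}` on `H^{(γ,c)}`. -/
def qGam (q γ x : ℝ) : Module.End ℂ (ℕ →₀ ℂ) := ((q ^ (x * γ) : ℝ) : ℂ) • LinearMap.id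

/-- `[Γ]_q^{1/2}` on `H^{(γ,c)}`. -/
def sqrtGam (q γ : ℝ) : Module.End ℂ (ℕ →₀ ℂ) := qNumSqrt q γ • LinearMap.id

/-- `[Γ]_q^{-1/2}` on `H^{(γ,c)}`. -/
def invSqrtGam (q γ : ℝ) : Module.End ℂ (ℕ →₀ ℂ) := (qNumSqrt q γ)⁻¹ • LinearMap.id

/-- `Δ^{(n)} α⁻`, with `Δ α⁻ = α⁻ ⊗ q^{Γ/2} + q^{-Γ/2} ⊗ α⁻`. -/
def coprodAlphaMinus (q γ : ℝ) (n : ℕ) : Module.End ℂ (TPow ℂ n) :=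
  skewPrimitive n (qGam q γ (-1 / 2)) (alphaMinus q γ) (qGam q γ (1 / 2))

/-- `Δ^{(n)} ε`. -/
def coprodEps (c : ℝ) (n : ℕ) : Module.End ℂ (TPow ℂ n) := ∑ k : Fin n, atSite k (eps c)

/-- `Δ^{(n)} Γ`. -/
def coprodGam (γ : ℝ) (n : ℕ) : Module.End ℂ (TPow ℂ n) := ∑ k : Fin n, atSite k (gam γ)

/-- The weight space of `(H^{(γ,c)})^{⊗ n}` for the weights `g` of `Γ` and `e` of `ε`. -/
def weightSpace (γ c : ℝ) (n : ℕ) (g e : ℝ) : Submodule ℂ (TPow ℂ n) :=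
  LinearMap.ker (coprodGam γ n - (g : ℂ) • LinearMap.id) ⊓
    LinearMap.ker (coprodEps c n - (e : ℂ) • LinearMap.id)

/-- The lowest weight space `V^{(e)}` of `(H^{(γ,c)})^{⊗ n}`. -/
def lowestWeightSpace (q γ c : ℝ) (n : ℕ) (e : ℝ) : Submodule ℂ (TPow ℂ n) :=
  weightSpace γ c n (n * γ) e ⊓ LinearMap.ker (coprodAlphaMinus q γ n)

/-- The operator
`𝒪 = q^{-Γ/2} [Γ]^{-1/2} α⁺ ⊗ [Γ]^{1/2} - [Γ]^{1/2} ⊗ q^{Γ/2} [Γ]^{-1/2} α⁺`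
in the positions `lft i` and `rgt i`. -/
def opO (q γ : ℝ) {n : ℕ} (i : Fin (n - 1)) : Module.End ℂ (TPow ℂ n) :=
  atPair i (qGam q γ (-1 / 2) * invSqrtGam q γ * alphaPlus q γ) (sqrtGam q γ) -
    atPair i (sqrtGam q γ) (qGam q γ (1 / 2) * invSqrtGam q γ * alphaPlus q γ)

/-- `v_0 = h_0 ⊗ ⋯ ⊗ h_0`. -/
def v0 (n : ℕ) : TPow ℂ n := tBasis ℂ n 0

/-- `w_{i,j} = 𝒪_i 𝒪_j v_0`. -/
def w (q γ : ℝ) {n : ℕ} (i j : Fin (n - 1)) : TPow ℂ n := opO q γ i (opO q γ j (v0 n))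

/-- `q^{-(ε ⊗ Γ + Γ ⊗ ε)}` in the positions `lft i` and `rgt i`. -/
def cartanPart (q γ c : ℝ) {n : ℕ} (i : Fin (n - 1)) : Module.End ℂ (TPow ℂ n) :=
  (tBasis ℂ n).constr ℂ fun m =>
    ((q ^ (-((m (lft i) + c) * γ + γ * (m (rgt i) + c))) : ℝ) : ℂ) • tBasis ℂ n m

/-- `(q - q⁻¹) (q^{Γ/2} ⊗ q^{-Γ/2}) (α⁻ ⊗ α⁺)` in the positions `lft i` and `rgt i`. -/
def nilPart (q γ : ℝ) {n : ℕ} (i : Fin (n - 1)) : Module.End ℂ (TPow ℂ n) :=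
  ((q : ℂ) - (q : ℂ)⁻¹) •
    (atPair i (qGam q γ (1 / 2)) (qGam q γ (-1 / 2)) *
      atPair i (alphaMinus q γ) (alphaPlus q γ))

/-- The exponential of the locally nilpotent operator `nilPart`: on the basis vector
`h_{m_1} ⊗ ⋯ ⊗ h_{m_n}` the terms of the exponential series of order larger than
`m (lft i)` vanish, because `α⁻` lowers `h_m` to `h_{m-1}` and kills `h_0`. -/
def expNilPart (q γ : ℝ) {n : ℕ} (i : Fin (n - 1)) : Module.End ℂ (TPow ℂ n) :=
  (tBasis ℂ n).constr ℂ fun m =>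
    ∑ k ∈ Finset.range (m (lft i) + 1),
      ((k.factorial : ℂ)⁻¹) • (nilPart q γ i ^ k) (tBasis ℂ n m)

/-- `σ_i = 1 ⊗ ⋯ ⊗ 𝒫 ℜ ⊗ ⋯ ⊗ 1`, where `ℜ` is the R-matrix
`q^{-(ε ⊗ Γ + Γ ⊗ ε)} exp((q - q⁻¹) (q^{Γ/2} ⊗ q^{-Γ/2}) (α⁻ ⊗ α⁺))` and `𝒫` is the flip. -/
def sigma (q γ c : ℝ) {n : ℕ} (i : Fin (n - 1)) : Module.End ℂ (TPow ℂ n) :=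
  (PiTensorProduct.reindex ℂ (fun _ : Fin n => ℕ →₀ ℂ)
      (Equiv.swap (lft i) (rgt i))).toLinearMap ∘ₗ cartanPart q γ c i ∘ₗ expNilPart q γ i

/-- `σ_i` divided by the constant `q^{-2cγ}`, its eigenvalue on `v_0`. -/
def sigmaNorm (q γ c : ℝ) {n : ℕ} (i : Fin (n - 1)) : Module.End ℂ (TPow ℂ n) :=
  ((q ^ (2 * c * γ) : ℝ) : ℂ) • sigma q γ c i

end HOq

/-! ### The Jackson–Kerler representations -/

namespace JK

variable {K : Type} [Field K]

/-- The symmetric quantum binomial coefficient `[n choose k]_q`. -/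
def qBinom (q : K) : ℕ → ℕ → K
  | _, 0 => 1
  | 0, _ + 1 => 0
  | n + 1, k + 1 =>
      q ^ ((k : ℤ) + 1) * qBinom q n (k + 1) + q ^ ((k : ℤ) - n) * qBinom q n k

/-- `E` on the generic Verma module of `U_q(sl_2)`: `E v_j = v_{j-1}` and `E v_0 = 0`. -/
def opE : Module.End K (ℕ →₀ K) :=
  Finsupp.linearCombination K fun j : ℕ => if j = 0 then 0 else Finsupp.single (j - 1) (1 : K)

/-- `K` on the generic Verma module: `K v_j = s q^{-2j} v_j`. -/
def opK (q s : K) : Module.End K (ℕ →₀ K) :=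
  Finsupp.linearCombination K fun j : ℕ =>
    (s * q ^ (-2 * (j : ℤ))) • Finsupp.single j (1 : K)

/-- `E` on the `n`-th tensor power, with `Δ E = E ⊗ K + 1 ⊗ E`. -/
def coprodE (q s : K) (n : ℕ) : Module.End K (TPow K n) :=
  skewPrimitive n LinearMap.id opE (opK q s)

/-- The coefficient of `v_{j+k} ⊗ v_{i-k}` in the image of `v_i ⊗ v_j` under the braiding. -/
def rCoeff (q s : K) (i j k : ℕ) : K :=
  s ^ (-((i : ℤ) + j)) * q ^ (2 * (i - k) * (j + k)) * q ^ (k * (k - 1) / 2) *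
    qBinom q (k + j) j *
    ∏ r ∈ Finset.range k,
      (s * q ^ (-((r : ℤ) + j)) - s⁻¹ * q ^ ((r : ℤ) + j))

/-- The braiding in the positions `lft i` and `rgt i`. -/
def sigma (q s : K) {n : ℕ} (i : Fin (n - 1)) : Module.End K (TPow K n) :=
  (tBasis K n).constr K fun m =>
    ∑ k ∈ Finset.range (m (lft i) + 1),
      rCoeff q s (m (lft i)) (m (rgt i)) k •
        tBasis K n
          (Function.update (Function.update m (lft i) (m (rgt i) + k)) (rgt i) (m (lft i) - k))

/-- `V_{n,l}`, spanned by the `v_{m_1} ⊗ ⋯ ⊗ v_{m_n}` with `m_1 + ⋯ + m_n = l`. -/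
def V (K : Type) [Field K] (n l : ℕ) : Submodule K (TPow K n) :=
  Submodule.span K {x | ∃ m : Fin n → ℕ, ∑ a, m a = l ∧ x = tBasis K n m}

/-- The highest weight space `W_{n,l} = V_{n,l} ∩ ker E`. -/
def W (q s : K) (n l : ℕ) : Submodule K (TPow K n) := V K n l ⊓ LinearMap.ker (coprodE q s n)

/-- The vector `W_{i,j}` of `W_{n,2}` (for `i < j`). With `e_{i,j}` the basis vector that has `v_1`
in the positions `i` and `j`, and `e_{i,i}` the one that has `v_2` in the position `i`, it is
`e_{i,j} - s^{i-j} e_{i,i} - q^{-2} s^{j-i} e_{j,j}`. -/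
def vec (q s : K) {n : ℕ} (i j : Fin n) : TPow K n :=
  tBasis K n (Pi.single i 1 + Pi.single j 1) -
    s ^ ((i : ℤ) - (j : ℤ)) • tBasis K n (Pi.single i 2) -
    (q ^ (-2 : ℤ) * s ^ ((j : ℤ) - (i : ℤ))) • tBasis K n (Pi.single j 2)

end JK

/-! ### The Lawrence–Krammer–Bigelow representation -/

namespace LKB

/-- The index set of the basis `v_{j,k}`, `j < k`. -/
abbrev Idx (n : ℕ) : Type := {p : Fin n × Fin n // p.1 < p.2}

/-- `v_{j,k}`, read as `0` unless `j < k` (which holds wherever it is used). -/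
def v (K : Type) [Field K] {n : ℕ} (j k : Fin n) : Idx n →₀ K :=
  if h : j < k then Finsupp.single ⟨(j, k), h⟩ 1 else 0

/-- The image of `v_{j,k}` under the `i`-th generator, in Bigelow's normalization of the
parameters `q`, `t`; here the generator exchanges the points `a = lft i` and `b = rgt i`. -/
def gen {K : Type} [Field K] (q t : K) {n : ℕ} (i : Fin (n - 1)) (j k : Fin n) : Idx n →₀ K :=
  let a := lft i
  let b := rgt i
  if j = a ∧ k = b then (-t * q ^ 2) • v K j k
  else if j = b then q • v K a k + (q ^ 2 - q) • v K a j + (1 - q) • v K j k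
  else if j = a then v K b k
  else if k = b then q • v K j a + (1 - q) • v K j k - ((q ^ 2 - q) * t) • v K a k
  else if k = a then v K j b
  else v K j k

end LKB

end

open MvPolynomial

noncomputable section

namespace InvQuad

section Basics

variable (K : Type) [Field K] (n : ℕ)

/-- The infinitesimal simultaneous translation of all variables, `∑ ∂/∂u_k`. -/
def transl : Derivation K (MvPolynomial (Fin n) K) (MvPolynomial (Fin n) K) :=
  mkDerivation K fun _ => 1

/-- The translation invariant quadratic forms in `n` variables. -/
def quad : Submodule K (MvPolynomial (Fin n) K) :=
  homogeneousSubmodule (Fin n) K 2 ⊓ LinearMap.ker (transl K n).toLinearMap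

variable {K n}

@[simp] lemma transl_X (k : Fin n) : transl K n (X k) = 1 := mkDerivation_X _ _ _

@[simp] lemma transl_C (a : K) : transl K n (C a) = 0 := derivation_C _ _

lemma transl_eq_sum (p : MvPolynomial (Fin n) K) : transl K n p = ∑ k, pderiv k p := by
  induction p using MvPolynomial.induction_on with
  | C a => simp
  | add p r hp hr => simp [hp, hr, Finset.sum_add_distrib]
  | mul_X p k hp =>
    simp [Derivation.leibniz, hp, Finset.sum_add_distrib, Finset.mul_sum, pderiv_X,
      Pi.single_apply]

lemma mem_quad {p : MvPolynomial (Fin n) K} :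
    p ∈ quad K n ↔ p.IsHomogeneous 2 ∧ transl K n p = 0 := Iff.rfl

lemma mul_mem_quad {p r : MvPolynomial (Fin n) K} (hp : p.IsHomogeneous 1)
    (hp' : transl K n p = 0) (hr : r.IsHomogeneous 1) (hr' : transl K n r = 0) :
    p * r ∈ quad K n := by
  refine mem_quad.2 ⟨hp.mul hr, ?_⟩
  rw [Derivation.leibniz, hp', hr']
  simp

lemma isHomogeneous_X_sub_X (j k : Fin n) : (X j - X k : MvPolynomial (Fin n) K).IsHomogeneous 1 :=
  (isHomogeneous_X _ _).sub (isHomogeneous_X _ _)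

lemma transl_X_sub_X (j k : Fin n) : transl K n (X j - X k) = 0 := by simp

/-- A linear substitution whose coefficient rows sum to one preserves translation invariant
quadratic forms. -/
lemma algHom_mem_quad (F : MvPolynomial (Fin n) K →ₐ[K] MvPolynomial (Fin n) K)
    (h1 : ∀ k, (F (X k)).IsHomogeneous 1) (h2 : ∀ k, transl K n (F (X k)) = 1)
    {p : MvPolynomial (Fin n) K} (hp : p ∈ quad K n) : F p ∈ quad K n := by
  have key : ∀ p, transl K n (F p) = F (transl K n p) := by
    intro p
    induction p using MvPolynomial.induction_on with
    | C a => simp [← algebraMap_eq]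
    | add p r hp hr => simp [hp, hr]
    | mul_X p k hp => simp [Derivation.leibniz, hp, h2]
  refine mem_quad.2 ⟨?_, by rw [key, (mem_quad.1 hp).2, map_zero]⟩
  have h := hp.1.aeval (fun k => F (X k)) h1
  rw [one_mul] at h
  rw [aeval_unique F]
  exact h

end Basics

section Bases

variable {K : Type} [Field K] {n : ℕ}

lemma sqDiff_mem (j k : Fin n) : (X j - X k : MvPolynomial (Fin n) K) ^ 2 ∈ quad K n := by
  rw [pow_two]
  exact mul_mem_quad (isHomogeneous_X_sub_X _ _) (transl_X_sub_X _ _)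
    (isHomogeneous_X_sub_X _ _) (transl_X_sub_X _ _)

lemma coeff_sqDiff (j k a b : Fin n) (hjk : j < k) (hab : a < b) :
    coeff (Finsupp.single a 1 + Finsupp.single b 1) ((X j - X k : MvPolynomial (Fin n) K) ^ 2) =
      if a = j ∧ b = k then -2 else 0 := by
  have hX : ∀ i l : Fin n, (X i * X l : MvPolynomial (Fin n) K) =
      monomial (Finsupp.single i 1 + Finsupp.single l 1) 1 := by
    intro i l; simp [X, monomial_mul]
  have hne : ∀ i l : Fin n, i ≤ l → ((Finsupp.single i 1 + Finsupp.single l 1 : Fin n →₀ ℕ) =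
      Finsupp.single a 1 + Finsupp.single b 1 ↔ i = a ∧ l = b) := by
    intro i l hil
    constructor
    · intro h
      have ha := DFunLike.congr_fun h a
      have hb := DFunLike.congr_fun h b
      simp only [Finsupp.add_apply, Finsupp.single_apply] at ha hb
      simp only [if_pos, hab.ne', hab.ne, if_false] at ha hb
      split_ifs at ha hb <;> omega
    · rintro ⟨rfl, rfl⟩; rfl
  have : (X j - X k : MvPolynomial (Fin n) K) ^ 2 =
      X j * X j - (2 : K) • (X j * X k) + X k * X k := by
    rw [MvPolynomial.smul_eq_C_mul, map_ofNat]; ring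
  rw [this, hX, hX, hX, coeff_add, coeff_sub, coeff_smul, coeff_monomial, coeff_monomial,
    coeff_monomial]
  simp only [hne _ _ le_rfl, hne _ _ hjk.le]
  have h1 : ¬ (j = a ∧ j = b) := fun h => hab.ne (h.1.symm.trans h.2)
  have h2 : ¬ (k = a ∧ k = b) := fun h => hab.ne (h.1.symm.trans h.2)
  simp only [h1, h2, if_false, eq_comm (a := a), eq_comm (a := b)]
  split_ifs <;> simp

/-- A simple difference `u_i - u_{i+1}` of neighbouring variables. -/
def stepDiff (K : Type) [Field K] (i : Fin (n - 1)) : MvPolynomial (Fin n) K :=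
  X (lft i) - X (rgt i)

lemma stepDiff_mul_mem (i j : Fin (n - 1)) : stepDiff K i * stepDiff K j ∈ quad K n :=
  mul_mem_quad (isHomogeneous_X_sub_X _ _) (transl_X_sub_X _ _)
    (isHomogeneous_X_sub_X _ _) (transl_X_sub_X _ _)

lemma X_sub_X_mem_span (j k : Fin n) (h : j ≤ k) :
    (X j - X k : MvPolynomial (Fin n) K) ∈ Submodule.span K (Set.range (stepDiff (n := n) K)) := by
  obtain ⟨k, hk⟩ := k
  induction k with
  | zero =>
    have : j = ⟨0, hk⟩ := le_antisymm h (Nat.zero_le _)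
    rw [this, sub_self]
    exact zero_mem _
  | succ k ih =>
    rcases h.lt_or_eq with h | h
    · have h1 := ih (by omega) (Nat.le_of_lt_succ h)
      have h2 : stepDiff K (⟨k, by omega⟩ : Fin (n - 1)) ∈
        Submodule.span K (Set.range (stepDiff (n := n) K)) := Submodule.subset_span ⟨_, rfl⟩
      have := add_mem h1 h2
      simpa [stepDiff, lft, rgt] using this
    · rw [h, sub_self]
      exact zero_mem _

/-- An exponent of degree two is a sum of two unit vectors. -/
lemma exists_of_degree_two (d : Fin n →₀ ℕ) (hd : d.degree = 2) :
    ∃ a b : Fin n, a ≤ b ∧ d = Finsupp.single a 1 + Finsupp.single b 1 := by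
  classical
  have h0 : d ≠ 0 := by rintro rfl; simp at hd
  obtain ⟨a, ha⟩ := Finsupp.ne_iff.1 h0
  have hle : Finsupp.single a 1 ≤ d := by
    rw [Finsupp.single_le_iff]; simpa [Nat.one_le_iff_ne_zero] using ha
  obtain ⟨e, rfl⟩ := exists_add_of_le hle
  have he : e.degree = 1 := by simp [map_add] at hd; omega
  have h1 : e ≠ 0 := by rintro rfl; simp at he
  obtain ⟨b, hb⟩ := Finsupp.ne_iff.1 h1
  have hle' : Finsupp.single b 1 ≤ e := by
    rw [Finsupp.single_le_iff]; simpa [Nat.one_le_iff_ne_zero] using hb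
  obtain ⟨f, rfl⟩ := exists_add_of_le hle'
  have hf : f.degree = 0 := by simp [map_add] at he; omega
  obtain rfl := (Finsupp.degree_eq_zero_iff f).1 hf
  rw [add_zero]
  rcases le_total a b with h | h
  · exact ⟨a, b, h, rfl⟩
  · exact ⟨b, a, h, add_comm _ _⟩

variable [CharZero K]

lemma linearIndependent_sqDiff :
    LinearIndependent K fun p : LKB.Idx n =>
      (⟨(X p.1.1 - X p.1.2) ^ 2, sqDiff_mem _ _⟩ : quad K n) := by
  rw [Fintype.linearIndependent_iff]
  intro g hg p
  have h := congrArg (fun x : quad K n =>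
    coeff (Finsupp.single p.1.1 1 + Finsupp.single p.1.2 1) (x : MvPolynomial (Fin n) K)) hg
  simp only [Submodule.coe_sum, Submodule.coe_smul, coeff_sum, coeff_smul, ZeroMemClass.coe_zero,
    coeff_zero] at h
  rw [Finset.sum_eq_single p] at h
  · rw [coeff_sqDiff _ _ _ _ p.2 p.2] at h
    simpa using h
  · intro b _ hb
    rw [coeff_sqDiff _ _ _ _ b.2 p.2, if_neg, smul_zero]
    rintro ⟨h1, h2⟩
    exact hb (Subtype.ext (Prod.ext h1.symm h2.symm))
  · simp

lemma eq_zero_of_coeff_eq_zero {g : MvPolynomial (Fin n) K} (hg : g ∈ quad K n)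
    (h : ∀ a b : Fin n, a < b → coeff (Finsupp.single a 1 + Finsupp.single b 1) g = 0) :
    g = 0 := by
  have hform : g = ∑ k, monomial (Finsupp.single k 1 + Finsupp.single k 1)
      (coeff (Finsupp.single k 1 + Finsupp.single k 1) g) := by
    ext d
    rw [coeff_sum]
    simp only [coeff_monomial]
    by_cases hd : d.degree = 2
    · obtain ⟨a, b, hab, rfl⟩ := exists_of_degree_two d hd
      rcases hab.lt_or_eq with hab | rfl
      · rw [h a b hab, Finset.sum_eq_zero]
        intro k _
        rw [if_neg]
        intro hk
        have ha := DFunLike.congr_fun hk a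
        have hb := DFunLike.congr_fun hk b
        simp only [Finsupp.add_apply, Finsupp.single_apply] at ha hb
        simp only [if_pos, hab.ne', hab.ne, if_false] at ha hb
        split_ifs at ha hb
        all_goals omega
      · rw [Finset.sum_eq_single a]
        · simp
        · intro b _ hb
          rw [if_neg]
          intro hk
          have hb' := DFunLike.congr_fun hk b
          simp [hb.symm] at hb'
        · simp
    · rw [hg.1.coeff_eq_zero hd, Finset.sum_eq_zero]
      intro k _
      rw [if_neg]
      rintro rfl
      simp [map_add] at hd
  have hz : ∀ k : Fin n, coeff (Finsupp.single k 1 + Finsupp.single k 1) g = 0 := by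
    intro k
    have h2 : transl K n g = 0 := hg.2
    rw [hform, map_sum] at h2
    have h3 : ∀ l : Fin n, transl K n (monomial (Finsupp.single l 1 + Finsupp.single l 1)
        (coeff (Finsupp.single l 1 + Finsupp.single l 1) g)) =
        (2 * coeff (Finsupp.single l 1 + Finsupp.single l 1) g) • X l := by
      intro l
      have : (monomial (Finsupp.single l 1 + Finsupp.single l 1)
        (coeff (Finsupp.single l 1 + Finsupp.single l 1) g)) =
        coeff (Finsupp.single l 1 + Finsupp.single l 1) g • (X l * X l) := by
        simp [X, monomial_mul, smul_monomial]
      rw [this, Derivation.map_smul, Derivation.leibniz, transl_X, mul_comm, mul_smul]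
      congr 1
      simp only [smul_eq_mul, mul_one, two_smul]
    simp only [h3] at h2
    have h4 := congrArg (coeff (Finsupp.single k 1)) h2
    rw [coeff_sum] at h4
    simpa [coeff_X, Finsupp.single_left_inj, eq_comm] using h4
  rw [hform]
  simp [hz]

lemma top_le_span_sqDiff :
    ⊤ ≤ Submodule.span K (Set.range fun p : LKB.Idx n =>
      (⟨(X p.1.1 - X p.1.2) ^ 2, sqDiff_mem _ _⟩ : quad K n)) := by
  rintro f -
  set B : LKB.Idx n → quad K n := fun p => ⟨(X p.1.1 - X p.1.2) ^ 2, sqDiff_mem _ _⟩ with hB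
  set c : LKB.Idx n → K := fun p =>
    coeff (Finsupp.single p.1.1 1 + Finsupp.single p.1.2 1) (f : MvPolynomial (Fin n) K) with hc
  have : f = ∑ p, (-(c p) / 2) • B p := by
    rw [← sub_eq_zero]
    apply Subtype.ext
    refine eq_zero_of_coeff_eq_zero (Subtype.mem _) fun a b hab => ?_
    simp only [AddSubgroupClass.coe_sub, Submodule.coe_sum, Submodule.coe_smul, coeff_sub,
      coeff_sum, coeff_smul]
    rw [Finset.sum_eq_single (⟨(a, b), hab⟩ : LKB.Idx n)]
    · simp only [hB, coeff_sqDiff _ _ _ _ hab hab, hc]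
      simp
    · intro p _ hp
      simp only [hB]
      rw [coeff_sqDiff _ _ _ _ p.2 hab, if_neg, smul_zero]
      rintro ⟨rfl, rfl⟩
      exact hp rfl
    · simp
  rw [this]
  exact Submodule.sum_mem _ fun p _ =>
    Submodule.smul_mem _ _ (Submodule.subset_span ⟨p, rfl⟩)

/-- The squares `(u_j - u_k)^2`, `j < k`, form a basis of the translation invariant quadratic
forms. -/
def sqDiffBasis : Module.Basis (LKB.Idx n) K (quad K n) :=
  Module.Basis.mk linearIndependent_sqDiff top_le_span_sqDiff

lemma coe_sqDiffBasis (p : LKB.Idx n) :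
    (sqDiffBasis (K := K) p : MvPolynomial (Fin n) K) = (X p.1.1 - X p.1.2) ^ 2 := by
  rw [sqDiffBasis, Module.Basis.mk_apply]

lemma card_idx (n : ℕ) : Fintype.card (LKB.Idx n) = n * (n - 1) / 2 := by
  have e : LKB.Idx n ≃ Σ k : Fin n, Fin k :=
    { toFun := fun p => ⟨p.1.2, ⟨p.1.1, p.2⟩⟩
      invFun := fun x => ⟨(⟨x.2, x.2.2.trans x.1.2⟩, x.1), x.2.2⟩
      left_inv := fun _ => rfl
      right_inv := fun _ => rfl }
  rw [Fintype.card_congr e, Fintype.card_sigma]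
  simp only [Fintype.card_fin]
  rw [Fin.sum_univ_eq_sum_range (fun k => k), Finset.sum_range_id]

lemma card_pairs (n : ℕ) :
    Fintype.card {p : Fin (n - 1) × Fin (n - 1) // p.1 ≤ p.2} = n * (n - 1) / 2 := by
  rw [← card_idx]
  refine Fintype.card_congr
    { toFun := fun p => ⟨(lft p.1.1, rgt p.1.2), ?_⟩
      invFun := fun x => ⟨(⟨x.1.1, ?_⟩, ⟨(x.1.2 : ℕ) - 1, ?_⟩), ?_⟩
      left_inv := fun p => ?_
      right_inv := fun x => ?_ }
  · have := p.2
    rw [Fin.le_def] at this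
    simp only [lft, rgt, Fin.lt_def]
    omega
  · have := x.2
    rw [Fin.lt_def] at this
    omega
  · have := x.2
    rw [Fin.lt_def] at this
    omega
  · have := x.2
    rw [Fin.lt_def] at this
    simp only [Fin.le_def]
    omega
  · rfl
  · have := x.2
    rw [Fin.lt_def] at this
    apply Subtype.ext
    apply Prod.ext
    · rfl
    · apply Fin.ext
      simp only [rgt]
      omega

lemma finrank_quad : Module.finrank K (quad K n) = n * (n - 1) / 2 := by
  rw [Module.finrank_eq_card_basis (sqDiffBasis (K := K)), card_idx]

instance : Module.Finite K (quad K n) := Module.Finite.of_basis sqDiffBasis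

open scoped Pointwise in
/-- The products of two simple differences span. -/
lemma span_stepDiff_mul {ι : Type*} (B : ι → quad K n)
    (hB : ∀ i j : Fin (n - 1), i ≤ j → (⟨_, stepDiff_mul_mem i j⟩ : quad K n) ∈
      Submodule.span K (Set.range B)) :
    ⊤ ≤ Submodule.span K (Set.range B) := by
  refine top_le_span_sqDiff.trans (Submodule.span_le.2 ?_)
  rintro _ ⟨p, rfl⟩
  have hm : (X p.1.1 - X p.1.2 : MvPolynomial (Fin n) K) ^ 2 ∈
      Submodule.span K (Set.range (stepDiff (n := n) K)) *
        Submodule.span K (Set.range (stepDiff (n := n) K)) := by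
    rw [pow_two]
    exact Submodule.mul_mem_mul (X_sub_X_mem_span _ _ p.2.le) (X_sub_X_mem_span _ _ p.2.le)
  rw [Submodule.span_mul_span] at hm
  have hle : Submodule.span K (Set.range (stepDiff (n := n) K) *
      Set.range (stepDiff (n := n) K)) ≤
      (Submodule.span K (Set.range B)).map (quad K n).subtype := by
    refine Submodule.span_le.2 ?_
    rintro _ ⟨_, ⟨i, rfl⟩, _, ⟨j, rfl⟩, rfl⟩
    rcases le_total i j with h | h
    · exact ⟨_, hB i j h, rfl⟩
    · exact ⟨_, hB j i h, mul_comm _ _⟩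
  obtain ⟨y, hy, hy'⟩ := hle hm
  have : y = ⟨_, sqDiff_mem p.1.1 p.1.2⟩ := Subtype.ext hy'
  rw [this] at hy
  exact hy

/-- A family indexed by the right number of elements is a basis as soon as it spans the products
of simple differences. -/
def basisOfSpan {ι : Type*} [Fintype ι] (B : ι → quad K n)
    (hcard : Fintype.card ι = n * (n - 1) / 2)
    (hB : ∀ i j : Fin (n - 1), i ≤ j → (⟨_, stepDiff_mul_mem i j⟩ : quad K n) ∈
      Submodule.span K (Set.range B)) : Module.Basis ι K (quad K n) :=
  basisOfTopLeSpanOfCardEqFinrank B (span_stepDiff_mul B hB) (hcard.trans finrank_quad.symm)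

lemma basisOfSpan_apply {ι : Type*} [Fintype ι] (B : ι → quad K n)
    (hcard : Fintype.card ι = n * (n - 1) / 2)
    (hB : ∀ i j : Fin (n - 1), i ≤ j → (⟨_, stepDiff_mul_mem i j⟩ : quad K n) ∈
      Submodule.span K (Set.range B)) (x : ι) : basisOfSpan B hcard hB x = B x := by
  rw [basisOfSpan, coe_basisOfTopLeSpanOfCardEqFinrank]

end Bases

end InvQuad

namespace Representation

variable {K G V W : Type*} [CommSemiring K] [Monoid G] [AddCommMonoid V] [AddCommMonoid W]
  [Module K V] [Module K W]

/-- A representation transported along a linear equivalence. -/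
def transport (ρ : Representation K G V) (e : V ≃ₗ[K] W) : Representation K G W :=
  (e.conjRingEquiv : Module.End K V →* Module.End K W).comp ρ

lemma transport_apply (ρ : Representation K G V) (e : V ≃ₗ[K] W) (g : G) (x : W) :
    ρ.transport e g x = e (ρ g (e.symm x)) := rfl

/-- The equivalence of a representation with its transport. -/
def transportEquiv (ρ : Representation K G V) (e : V ≃ₗ[K] W) : ρ.Equiv (ρ.transport e) :=
  Equiv.mk e fun g => by
    ext x
    simp [transport_apply]

end Representation

namespace InvQuad

lemma lft_ne_rgt {n : ℕ} (i : Fin (n - 1)) : lft i ≠ rgt i := by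
  simp [lft, rgt, Fin.ext_iff]

section Burau

variable {K : Type} [Field K] {n : ℕ} (Q : K)

/-- The Burau substitution: `u_i ↦ (1 - Q) u_i + Q u_{i+1}` and `u_{i+1} ↦ u_i`. -/
def burau (i : Fin (n - 1)) : MvPolynomial (Fin n) K →ₐ[K] MvPolynomial (Fin n) K :=
  aeval fun k => if k = lft i then C (1 - Q) * X (lft i) + C Q * X (rgt i)
    else if k = rgt i then X (lft i) else X k

/-- The inverse of the Burau substitution. -/
def burauInv (i : Fin (n - 1)) : MvPolynomial (Fin n) K →ₐ[K] MvPolynomial (Fin n) K :=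
  aeval fun k => if k = lft i then X (rgt i)
    else if k = rgt i then C Q⁻¹ * (X (lft i) - C (1 - Q) * X (rgt i)) else X k

lemma burau_lft (i : Fin (n - 1)) :
    burau Q i (X (lft i)) = C (1 - Q) * X (lft i) + C Q * X (rgt i) := by
  simp [burau]

lemma burau_rgt (i : Fin (n - 1)) : burau Q i (X (rgt i)) = X (lft i) := by
  simp [burau, (lft_ne_rgt i).symm]

lemma burau_of_ne (i : Fin (n - 1)) {k : Fin n} (h1 : k ≠ lft i) (h2 : k ≠ rgt i) :
    burau Q i (X k) = X k := by
  simp [burau, h1, h2]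

@[simp] lemma burau_C (i : Fin (n - 1)) (a : K) : burau Q i (C a) = C a := algHom_C _ _

lemma burauInv_lft (i : Fin (n - 1)) : burauInv Q i (X (lft i)) = X (rgt i) := by
  simp [burauInv]

lemma burauInv_rgt (i : Fin (n - 1)) :
    burauInv Q i (X (rgt i)) = C Q⁻¹ * (X (lft i) - C (1 - Q) * X (rgt i)) := by
  simp [burauInv, (lft_ne_rgt i).symm]

lemma burauInv_of_ne (i : Fin (n - 1)) {k : Fin n} (h1 : k ≠ lft i) (h2 : k ≠ rgt i) :
    burauInv Q i (X k) = X k := by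
  simp [burauInv, h1, h2]

@[simp] lemma burauInv_C (i : Fin (n - 1)) (a : K) : burauInv Q i (C a) = C a := algHom_C _ _

variable {Q}

lemma burau_burauInv (hQ : Q ≠ 0) (i : Fin (n - 1)) (p : MvPolynomial (Fin n) K) :
    burau Q i (burauInv Q i p) = p := by
  have hC : (C Q⁻¹ * C Q : MvPolynomial (Fin n) K) = 1 := by
    rw [← C_mul, inv_mul_cancel₀ hQ, C_1]
  have : (burau Q i).comp (burauInv Q i) = AlgHom.id K _ := by
    refine algHom_ext fun k => ?_
    rw [AlgHom.comp_apply, AlgHom.id_apply]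
    by_cases h1 : k = lft i
    · rw [h1, burauInv_lft, burau_rgt]
    by_cases h2 : k = rgt i
    · rw [h2, burauInv_rgt, map_mul, map_sub, map_mul, burau_lft, burau_rgt, burau_C, burau_C]
      linear_combination X (rgt i) * hC
    · rw [burauInv_of_ne Q i h1 h2, burau_of_ne Q i h1 h2]
  exact AlgHom.congr_fun this p

lemma burauInv_burau (hQ : Q ≠ 0) (i : Fin (n - 1)) (p : MvPolynomial (Fin n) K) :
    burauInv Q i (burau Q i p) = p := by
  have hC : (C Q⁻¹ * C Q : MvPolynomial (Fin n) K) = 1 := by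
    rw [← C_mul, inv_mul_cancel₀ hQ, C_1]
  have : (burauInv Q i).comp (burau Q i) = AlgHom.id K _ := by
    refine algHom_ext fun k => ?_
    rw [AlgHom.comp_apply, AlgHom.id_apply]
    by_cases h1 : k = lft i
    · rw [h1, burau_lft, map_add, map_mul, map_mul, burauInv_lft, burauInv_rgt, burauInv_C,
        burauInv_C]
      linear_combination (X (lft i) - C (1 - Q) * X (rgt i)) * hC
    by_cases h2 : k = rgt i
    · rw [h2, burau_rgt, burauInv_lft]
    · rw [burau_of_ne Q i h1 h2, burauInv_of_ne Q i h1 h2]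
  exact AlgHom.congr_fun this p

variable (Q) in
lemma burau_mem_quad (i : Fin (n - 1)) {p : MvPolynomial (Fin n) K} (hp : p ∈ quad K n) :
    burau Q i p ∈ quad K n := by
  refine algHom_mem_quad _ (fun k => ?_) (fun k => ?_) hp
  · by_cases h1 : k = lft i
    · rw [h1, burau_lft]
      exact ((isHomogeneous_X _ _).C_mul _).add ((isHomogeneous_X _ _).C_mul _)
    by_cases h2 : k = rgt i
    · rw [h2, burau_rgt]
      exact isHomogeneous_X _ _
    · rw [burau_of_ne Q i h1 h2]
      exact isHomogeneous_X _ _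
  · by_cases h1 : k = lft i
    · rw [h1, burau_lft]
      simp [Derivation.leibniz]
    by_cases h2 : k = rgt i
    · rw [h2, burau_rgt, transl_X]
    · rw [burau_of_ne Q i h1 h2, transl_X]

lemma burauInv_mem_quad (hQ : Q ≠ 0) (i : Fin (n - 1)) {p : MvPolynomial (Fin n) K}
    (hp : p ∈ quad K n) : burauInv Q i p ∈ quad K n := by
  refine algHom_mem_quad _ (fun k => ?_) (fun k => ?_) hp
  · by_cases h1 : k = lft i
    · rw [h1, burauInv_lft]
      exact isHomogeneous_X _ _
    by_cases h2 : k = rgt i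
    · rw [h2, burauInv_rgt]
      exact ((isHomogeneous_X _ _).sub ((isHomogeneous_X _ _).C_mul _)).C_mul _
    · rw [burauInv_of_ne Q i h1 h2]
      exact isHomogeneous_X _ _
  · by_cases h1 : k = lft i
    · rw [h1, burauInv_lft, transl_X]
    by_cases h2 : k = rgt i
    · rw [h2, burauInv_rgt]
      simp [Derivation.leibniz, ← C_mul, inv_mul_cancel₀ hQ]
    · rw [burauInv_of_ne Q i h1 h2, transl_X]

variable (Q) in
lemma burau_comm (i j : Fin (n - 1)) (hij : (i : ℕ) + 1 < j) (p : MvPolynomial (Fin n) K) :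
    burau Q i (burau Q j p) = burau Q j (burau Q i p) := by
  have hli : ∀ {k : Fin n}, (k = lft j ∨ k = rgt j) → burau Q i (X k) = X k := by
    intro k hk
    apply burau_of_ne <;> rcases hk with rfl | rfl <;>
      simp only [lft, rgt, ne_eq, Fin.mk.injEq] <;> omega
  have hlj : ∀ {k : Fin n}, (k = lft i ∨ k = rgt i) → burau Q j (X k) = X k := by
    intro k hk
    apply burau_of_ne <;> rcases hk with rfl | rfl <;>
      simp only [lft, rgt, ne_eq, Fin.mk.injEq] <;> omega
  have : (burau Q i).comp (burau Q j) = (burau Q j).comp (burau Q i) := by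
    refine algHom_ext fun k => ?_
    rw [AlgHom.comp_apply, AlgHom.comp_apply]
    by_cases h1 : k = lft i
    · subst h1
      simp [hlj, burau_lft]
    by_cases h2 : k = rgt i
    · subst h2
      simp [hlj, burau_rgt]
    by_cases h3 : k = lft j
    · subst h3
      simp [hli, burau_lft]
    by_cases h4 : k = rgt j
    · subst h4
      simp [hli, burau_rgt]
    · rw [burau_of_ne Q i h1 h2, burau_of_ne Q j h3 h4, burau_of_ne Q i h1 h2]
  exact AlgHom.congr_fun this p

variable (Q) in
lemma burau_braid (i j : Fin (n - 1)) (hij : (i : ℕ) + 1 = j) (p : MvPolynomial (Fin n) K) :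
    burau Q i (burau Q j (burau Q i p)) = burau Q j (burau Q i (burau Q j p)) := by
  have hm : lft j = rgt i := Fin.ext hij.symm
  have hi : burau Q i (X (rgt j)) = X (rgt j) := by
    apply burau_of_ne <;> simp only [lft, rgt, ne_eq, Fin.mk.injEq] <;> omega
  have hj : burau Q j (X (lft i)) = X (lft i) := by
    apply burau_of_ne <;> simp only [lft, rgt, ne_eq, Fin.mk.injEq] <;> omega
  have hjl := burau_lft Q j
  have hjr := burau_rgt Q j
  rw [hm] at hjl hjr
  have : (burau Q i).comp ((burau Q j).comp (burau Q i)) =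
      (burau Q j).comp ((burau Q i).comp (burau Q j)) := by
    refine algHom_ext fun k => ?_
    simp only [AlgHom.comp_apply]
    by_cases h1 : k = lft i
    · subst h1
      simp only [burau_lft, burau_rgt, hi, hj, hjl, map_add, map_mul, burau_C]
      simp only [C_sub, C_1]
      ring
    by_cases h2 : k = rgt i
    · subst h2
      simp only [burau_lft, burau_rgt, hi, hj, hjl, hjr, map_add, map_mul, burau_C]
    by_cases h4 : k = rgt j
    · subst h4
      simp only [burau_rgt, hi, hj, hjr]
    · rw [burau_of_ne Q i h1 h2, burau_of_ne Q j (hm ▸ h2) h4, burau_of_ne Q i h1 h2,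
        burau_of_ne Q j (hm ▸ h2) h4]
  exact AlgHom.congr_fun this p

/-- The action of the `i`-th braid generator on translation invariant quadratic forms. -/
def quadGen (hQ : Q ≠ 0) (i : Fin (n - 1)) : quad K n ≃ₗ[K] quad K n :=
  LinearEquiv.ofLinearMap
    ((burau Q i).toLinearMap.restrict fun _ hp => burau_mem_quad Q i hp)
    ((burauInv Q i).toLinearMap.restrict fun _ hp => burauInv_mem_quad hQ i hp)
    (LinearMap.ext fun p => Subtype.ext (burau_burauInv hQ i p))
    (LinearMap.ext fun p => Subtype.ext (burauInv_burau hQ i p))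

lemma coe_quadGen (hQ : Q ≠ 0) (i : Fin (n - 1)) (p : quad K n) :
    (quadGen hQ i p : MvPolynomial (Fin n) K) = burau Q i p := rfl

lemma lift_quadGen_eq_one (hQ : Q ≠ 0) :
    ∀ r ∈ braidRels n, FreeGroup.lift (quadGen (n := n) hQ) r = 1 := by
  rintro r ⟨i, j, ⟨hij, rfl⟩ | ⟨hij, rfl⟩⟩
  · simp only [map_mul, map_inv, FreeGroup.lift_apply_of]
    rw [mul_inv_eq_one]
    refine LinearEquiv.ext fun p => Subtype.ext ?_
    exact burau_comm Q i j hij p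
  · simp only [map_mul, map_inv, FreeGroup.lift_apply_of]
    rw [mul_inv_eq_one]
    refine LinearEquiv.ext fun p => Subtype.ext ?_
    exact burau_braid Q i j hij p

/-- The representation of the braid group on translation invariant quadratic forms: the symmetric
square of the reduced Burau representation. -/
def quadRep (hQ : Q ≠ 0) : Representation K (BraidGroup n) (quad K n) :=
  LinearEquiv.automorphismGroup.toLinearMapMonoidHom.comp
    (PresentedGroup.toGroup (lift_quadGen_eq_one hQ))

lemma quadRep_gen (hQ : Q ≠ 0) (i : Fin (n - 1)) (p : quad K n) :
    (quadRep hQ (braidGen i) p : MvPolynomial (Fin n) K) = burau Q i p := by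
  have : PresentedGroup.toGroup (lift_quadGen_eq_one (n := n) hQ) (braidGen i) = quadGen hQ i :=
    PresentedGroup.toGroup.of _
  rw [← coe_quadGen hQ, ← this]
  rfl

end Burau

section Forks

variable {K : Type} [Field K] {n : ℕ} (Q : K)

/-- The variables, indexed by natural numbers (and `0` out of range). -/
def var (K : Type) [Field K] (n l : ℕ) : MvPolynomial (Fin n) K :=
  if h : l < n then X ⟨l, h⟩ else 0

lemma var_coe (k : Fin n) : var K n k = X k := by simp [var]

lemma burau_var_self (i : Fin (n - 1)) :
    burau Q i (var K n i) = C (1 - Q) * var K n i + C Q * var K n (i + 1) := by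
  have h1 : var K n i = X (lft i) := var_coe (lft i)
  have h2 : var K n (i + 1) = X (rgt i) := var_coe (rgt i)
  rw [h1, h2, burau_lft]

lemma burau_var_succ (i : Fin (n - 1)) : burau Q i (var K n (i + 1)) = var K n i := by
  have h1 : var K n i = X (lft i) := var_coe (lft i)
  have h2 : var K n (i + 1) = X (rgt i) := var_coe (rgt i)
  rw [h1, h2, burau_rgt]

lemma burau_var_of_ne (i : Fin (n - 1)) {l : ℕ} (h1 : l ≠ i) (h2 : l ≠ i + 1) :
    burau Q i (var K n l) = var K n l := by
  rw [var]
  split_ifs with h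
  · exact burau_of_ne Q i (by simpa [lft, Fin.ext_iff]) (by simpa [rgt, Fin.ext_iff])
  · exact map_zero _

/-- The linear forms `(1 - Q) ∑_{l < k} Q^l u_l + Q^k u_k`, whose squared differences are permuted
by the braid generators like forks. -/
def fork (n k : ℕ) : MvPolynomial (Fin n) K :=
  C (1 - Q) * ∑ l ∈ Finset.range k, C (Q ^ l) * var K n l + C (Q ^ k) * var K n k

lemma fork_sub_fork_succ (k : ℕ) :
    fork Q n k - fork Q n (k + 1) = C (Q ^ (k + 1)) * (var K n k - var K n (k + 1)) := by
  simp only [fork, Finset.sum_range_succ, C_sub, C_pow, C_1]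
  ring

lemma burau_sum_var (i : Fin (n - 1)) {k : ℕ} (hk : k ≤ i ∨ (i : ℕ) + 2 ≤ k) :
    burau Q i (∑ l ∈ Finset.range k, C (Q ^ l) * var K n l) =
      ∑ l ∈ Finset.range k, C (Q ^ l) * var K n l := by
  rcases hk with hk | hk
  · rw [map_sum]
    refine Finset.sum_congr rfl fun l hl => ?_
    rw [Finset.mem_range] at hl
    rw [map_mul, burau_C, burau_var_of_ne] <;> omega
  · induction k, hk using Nat.le_induction with
    | base =>
      simp only [Finset.sum_range_succ, map_add, map_mul, burau_C, burau_var_self,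
        burau_var_succ, map_sum]
      rw [Finset.sum_congr rfl (g := fun l => C (Q ^ l) * var K n l)]
      · simp only [C_sub, C_pow, C_1]
        ring
      · intro l hl
        rw [Finset.mem_range] at hl
        rw [burau_var_of_ne] <;> omega
    | succ k hk ih =>
      rw [Finset.sum_range_succ, map_add, ih, map_mul, burau_C, burau_var_of_ne] <;> omega

lemma burau_fork_of_ne (i : Fin (n - 1)) {k : ℕ} (h1 : k ≠ i) (h2 : k ≠ i + 1) :
    burau Q i (fork Q n k) = fork Q n k := by
  rw [fork, map_add, map_mul, map_mul, burau_sum_var, burau_C, burau_C, burau_var_of_ne Q i h1 h2]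
  omega

lemma burau_fork_self (i : Fin (n - 1)) : burau Q i (fork Q n i) = fork Q n (i + 1) := by
  rw [fork, map_add, map_mul, map_mul, burau_sum_var _ _ (Or.inl le_rfl), burau_C, burau_C,
    burau_var_self, fork, Finset.sum_range_succ]
  simp only [C_sub, C_pow, C_1]
  ring

lemma burau_fork_succ (i : Fin (n - 1)) :
    burau Q i (fork Q n (i + 1)) = C Q * fork Q n i + C (1 - Q) * fork Q n (i + 1) := by
  rw [fork, Finset.sum_range_succ, map_add, map_mul, map_mul, map_add,
    burau_sum_var _ _ (Or.inl le_rfl), map_mul, burau_C, burau_C, burau_C,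
    burau_var_self, burau_var_succ]
  simp only [fork, C_sub, C_pow, C_1]
  ring

lemma isHomogeneous_fork (k : ℕ) : (fork Q n k).IsHomogeneous 1 := by
  have hv : ∀ l, (var K n l).IsHomogeneous 1 := by
    intro l
    rw [var]
    split_ifs
    · exact isHomogeneous_X _ _
    · exact isHomogeneous_zero _ _ _
  exact ((IsHomogeneous.sum _ _ _ fun l _ => (hv l).C_mul _).C_mul _).add ((hv k).C_mul _)

lemma transl_fork (k : ℕ) (hk : k < n) : transl K n (fork Q n k) = 1 := by
  induction k with
  | zero => simp [fork, var, hk]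
  | succ k ih =>
    have h := congrArg (transl K n) (fork_sub_fork_succ (n := n) Q k)
    have hv : ∀ l, l < n → transl K n (var K n l) = 1 := fun l hl => by simp [var, hl]
    rw [Derivation.leibniz, map_sub, map_sub, hv k (by omega), hv _ hk, ih (by omega)] at h
    simp only [sub_self, smul_zero, transl_C, add_zero] at h
    exact (sub_eq_zero.1 h).symm

lemma sqFork_mem (j k : Fin n) : (fork Q n j - fork Q n k) ^ 2 ∈ quad K n := by
  rw [pow_two]
  have h1 : (fork Q n j - fork Q n k).IsHomogeneous 1 :=
    (isHomogeneous_fork Q _).sub (isHomogeneous_fork Q _)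
  have h2 : transl K n (fork Q n j - fork Q n k) = 0 := by
    rw [map_sub, transl_fork Q _ j.2, transl_fork Q _ k.2, sub_self]
  exact mul_mem_quad h1 h2 h1 h2

variable [CharZero K] {Q}

lemma stepDiff_mul_mem_span_sqFork (hQ : Q ≠ 0) (i j : Fin (n - 1)) :
    (⟨_, stepDiff_mul_mem i j⟩ : quad K n) ∈ Submodule.span K
      (Set.range fun p : LKB.Idx n => (⟨_, sqFork_mem Q p.1.1 p.1.2⟩ : quad K n)) := by
  have hS : ∀ a b : Fin n, (⟨_, sqFork_mem Q a b⟩ : quad K n) ∈ Submodule.span K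
      (Set.range fun p : LKB.Idx n => (⟨_, sqFork_mem Q p.1.1 p.1.2⟩ : quad K n)) := by
    intro a b
    rcases lt_trichotomy a b with h | rfl | h
    · exact Submodule.subset_span ⟨⟨(a, b), h⟩, rfl⟩
    · have h0 : (⟨_, sqFork_mem Q a a⟩ : quad K n) = 0 := Subtype.ext (by simp)
      rw [h0]
      exact zero_mem _
    · refine Submodule.subset_span ⟨⟨(b, a), h⟩, Subtype.ext ?_⟩
      simp only
      ring
  have key : (⟨_, stepDiff_mul_mem i j⟩ : quad K n) =
      (2 * Q ^ ((i : ℕ) + 1) * Q ^ ((j : ℕ) + 1))⁻¹ •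
        ((⟨_, sqFork_mem Q (lft i) (rgt j)⟩ : quad K n) + ⟨_, sqFork_mem Q (rgt i) (lft j)⟩ -
          ⟨_, sqFork_mem Q (lft i) (lft j)⟩ - ⟨_, sqFork_mem Q (rgt i) (rgt j)⟩) := by
    rw [eq_inv_smul_iff₀ (mul_ne_zero (mul_ne_zero two_ne_zero (pow_ne_zero _ hQ)) (pow_ne_zero _ hQ))]
    apply Subtype.ext
    have hi := fork_sub_fork_succ (n := n) Q i
    have hj := fork_sub_fork_succ (n := n) Q j
    have e1 : ∀ i : Fin (n - 1), stepDiff K i = var K n i - var K n (i + 1) := by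
      intro i
      rw [stepDiff, ← var_coe, ← var_coe]
      rfl
    simp only [Submodule.coe_smul, AddSubgroupClass.coe_sub, Submodule.coe_add, e1, lft, rgt,
      MvPolynomial.smul_eq_C_mul, C_mul, map_ofNat]
    linear_combination (-2 * C (Q ^ ((j : ℕ) + 1)) * (var K n j - var K n (j + 1))) * hi -
      2 * (fork Q n i - fork Q n (i + 1)) * hj
  rw [key]
  exact Submodule.smul_mem _ _ (sub_mem (sub_mem (add_mem (hS _ _) (hS _ _)) (hS _ _)) (hS _ _))

/-- The basis of translation invariant quadratic forms on which the braid group acts by the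
Lawrence–Krammer–Bigelow formulas. -/
def forkBasis (hQ : Q ≠ 0) : Module.Basis (LKB.Idx n) K (quad K n) :=
  basisOfSpan (fun p => ⟨_, sqFork_mem Q p.1.1 p.1.2⟩) (card_idx n)
    fun i j _ => stepDiff_mul_mem_span_sqFork hQ i j

lemma forkBasis_repr_symm_v (hQ : Q ≠ 0) {j k : Fin n} (h : j < k) :
    ((forkBasis hQ).repr.symm (LKB.v K j k) : MvPolynomial (Fin n) K) =
      (fork Q n j - fork Q n k) ^ 2 := by
  rw [LKB.v, dif_pos h, Module.Basis.repr_symm_single_one, forkBasis, basisOfSpan_apply]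

/-- The Lawrence–Krammer–Bigelow representation at `t = -1`. -/
def lkbRep (hQ : Q ≠ 0) : Representation K (BraidGroup n) (LKB.Idx n →₀ K) :=
  (quadRep hQ).transport (forkBasis hQ).repr

lemma lkbRep_gen (hQ : Q ≠ 0) (i : Fin (n - 1)) (j k : Fin n) (hjk : j < k) :
    lkbRep hQ (braidGen i) (LKB.v K j k) = LKB.gen Q (-1) i j k := by
  rw [← (forkBasis hQ).repr.symm.injective.eq_iff]
  apply Subtype.ext
  have hL : ((forkBasis hQ).repr.symm (lkbRep hQ (braidGen i) (LKB.v K j k)) :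
      MvPolynomial (Fin n) K) = burau Q i ((fork Q n j - fork Q n k) ^ 2) := by
    rw [← forkBasis_repr_symm_v hQ hjk, ← quadRep_gen hQ]
    simp [lkbRep, Representation.transport_apply]
  rw [hL, map_pow, map_sub]
  have hlt : lft i < rgt i := by simp [lft, rgt]
  have hl : (lft i : ℕ) = i := rfl
  have hr : (rgt i : ℕ) = i + 1 := rfl
  have hs := burau_fork_self (K := K) (n := n) Q i
  have ht := burau_fork_succ (K := K) (n := n) Q i
  have hne : ∀ k : Fin n, k ≠ lft i → k ≠ rgt i → burau Q i (fork Q n k) = fork Q n k :=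
    fun k h1 h2 => burau_fork_of_ne Q i (fun h => h1 (Fin.ext h)) (fun h => h2 (Fin.ext h))
  rw [Fin.lt_def] at hjk
  simp only [LKB.gen]
  split_ifs with h1 h2 h3 h4 h5
  · obtain ⟨rfl, rfl⟩ := h1
    rw [map_smul, Submodule.coe_smul, forkBasis_repr_symm_v hQ hlt, hl, hr, hs, ht]
    simp only [MvPolynomial.smul_eq_C_mul, C_mul, C_neg, C_sub, C_1, C_pow]
    ring
  · subst h2
    have hk : burau Q i (fork Q n k) = fork Q n k := hne k (by omega) (by omega)
    simp only [map_add, map_smul, Submodule.coe_add, Submodule.coe_smul]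
    rw [forkBasis_repr_symm_v hQ (hlt.trans hjk), forkBasis_repr_symm_v hQ hlt,
      forkBasis_repr_symm_v hQ hjk, hk, hl, hr, ht]
    simp only [MvPolynomial.smul_eq_C_mul, C_sub, C_1, C_pow]
    ring
  · subst h3
    have hk' : k ≠ rgt i := fun h => h1 ⟨rfl, h⟩
    have hk : burau Q i (fork Q n k) = fork Q n k := hne k (by omega) hk'
    rw [forkBasis_repr_symm_v hQ (by rw [Fin.lt_def]; omega), hk, hl, hr, hs]
  · subst h4
    have hj : burau Q i (fork Q n j) = fork Q n j := hne j h3 (by omega)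
    simp only [map_add, map_sub, map_smul, Submodule.coe_add, AddSubgroupClass.coe_sub,
      Submodule.coe_smul]
    rw [forkBasis_repr_symm_v hQ (by rw [Fin.lt_def]; omega), forkBasis_repr_symm_v hQ hlt,
      forkBasis_repr_symm_v hQ hjk, hj, hl, hr, ht]
    simp only [MvPolynomial.smul_eq_C_mul, C_mul, C_neg, C_sub, C_1, C_pow]
    ring
  · subst h5
    have hj : burau Q i (fork Q n j) = fork Q n j := hne j h3 h2
    rw [forkBasis_repr_symm_v hQ (hlt.trans' hjk), hj, hl, hr, hs]
  · rw [forkBasis_repr_symm_v hQ hjk, hne j h3 h2, hne k h5 h4]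

end Forks

section ToPoly

variable {K : Type} [Field K] {n : ℕ}

lemma tBasis_eq_tprod (m : Fin n → ℕ) :
    tBasis K n m = PiTensorProduct.tprod K fun j => Finsupp.single (m j) (1 : K) := by
  simp [tBasis, Basis.piTensorProduct_apply]

lemma map_tBasis (f : Fin n → Module.End K (ℕ →₀ K)) (m m' : Fin n → ℕ) (c : Fin n → K)
    (h : ∀ j, f j (Finsupp.single (m j) 1) = c j • Finsupp.single (m' j) 1) :
    PiTensorProduct.map f (tBasis K n m) = (∏ j, c j) • tBasis K n m' := by
  rw [tBasis_eq_tprod, PiTensorProduct.map_tprod]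
  simp only [h]
  rw [MultilinearMap.map_smul_univ, tBasis_eq_tprod]

lemma map_smul_univ' (f : Fin n → Module.End K (ℕ →₀ K)) (c : Fin n → K) :
    PiTensorProduct.map (fun j => c j • f j) = (∏ j, c j) • PiTensorProduct.map f :=
  (PiTensorProduct.mapMultilinear K (fun _ : Fin n => ℕ →₀ K) fun _ => ℕ →₀ K).map_smul_univ c f

lemma atPair_eq_mul (i : Fin (n - 1)) (A B : Module.End K (ℕ →₀ K)) :
    atPair i A B = atSite (lft i) A * atSite (rgt i) B := by
  rw [atPair, atSite, atSite, ← PiTensorProduct.map_mul]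
  congr 1
  funext j
  have := lft_ne_rgt i
  by_cases h1 : j = lft i
  · subst h1
    simp only [if_pos, this, if_false]
    rfl
  · simp only [h1, if_false]
    rfl

lemma atSite_smul (k : Fin n) (c : K) (A : Module.End K (ℕ →₀ K)) :
    atSite k (c • A) = c • atSite k A := by
  have h := map_smul_univ' (fun j => if j = k then A else LinearMap.id)
    (fun j : Fin n => if j = k then c else 1)
  rw [Finset.prod_ite_eq' Finset.univ k fun _ => c, if_pos (Finset.mem_univ _)] at h
  rw [atSite, atSite, ← h]
  congr 1
  funext j
  split_ifs <;> simp

lemma atSite_id (k : Fin n) : atSite k (LinearMap.id : Module.End K (ℕ →₀ K)) = 1 := by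
  simp [atSite, PiTensorProduct.map_id, Module.End.one_eq_id]

lemma skewPrimitive_smul_id (l r : K) (A : Module.End K (ℕ →₀ K)) :
    skewPrimitive n (l • LinearMap.id) A (r • LinearMap.id) =
      ∑ k : Fin n, (l ^ (k : ℕ) * r ^ (n - 1 - (k : ℕ))) • atSite k A := by
  refine Finset.sum_congr rfl fun k _ => ?_
  have h := map_smul_univ' (fun j => if j = k then A else LinearMap.id)
    (fun j : Fin n => if j < k then l else if j = k then 1 else r)
  have hc : (∏ j : Fin n, if j < k then l else if j = k then 1 else r) =
      l ^ (k : ℕ) * r ^ (n - 1 - (k : ℕ)) := by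
    rw [Finset.prod_ite, Finset.prod_const, Finset.prod_ite, Finset.prod_const,
      Finset.prod_const, one_pow, one_mul, Finset.filter_filter]
    have e1 : (Finset.univ.filter fun j : Fin n => j < k) = Finset.Iio k := by
      ext; simp
    have e2 : (Finset.univ.filter fun j : Fin n => ¬ j < k ∧ ¬ j = k) = Finset.Ioi k := by
      ext j
      simp only [Finset.mem_filter, Finset.mem_univ, true_and, Finset.mem_Ioi, not_lt]
      exact ⟨fun h => lt_of_le_of_ne h.1 (Ne.symm h.2), fun h => ⟨h.le, h.ne'⟩⟩
    rw [e1, e2, Fin.card_Iio, Fin.card_Ioi]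
  rw [hc] at h
  rw [atSite, ← h]
  congr 1
  funext j
  by_cases h1 : j < k
  · simp [h1, h1.ne]
  · by_cases h2 : j = k
    · simp [h2]
    · simp [h1, h2]

variable (φ : Fin n → ℕ → K) (hφ : ∀ k a, φ k a ≠ 0)

/-- The identification of the tensor power with polynomials in `n` variables that sends
`e_{m_1} ⊗ ⋯ ⊗ e_{m_n}` to the product of the `φ_k(m_k) u_k^{m_k}`. -/
def toPoly : TPow K n ≃ₗ[K] MvPolynomial (Fin n) K :=
  (tBasis K n).equiv
    ((basisMonomials (Fin n) K).isUnitSMul (w := fun d => ∏ k, φ k (d k))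
      fun d => (Finset.prod_ne_zero_iff.2 fun k _ => hφ k (d k)).isUnit)
    Finsupp.equivFunOnFinite.symm

lemma toPoly_tBasis (m : Fin n → ℕ) :
    toPoly φ hφ (tBasis K n m) =
      monomial (Finsupp.equivFunOnFinite.symm m) (∏ k, φ k (m k)) := by
  rw [toPoly, Module.Basis.equiv_apply, Module.Basis.isUnitSMul_apply, coe_basisMonomials,
    smul_monomial]
  simp

lemma toPoly_tBasis_eq_prod (m : Fin n → ℕ) :
    toPoly φ hφ (tBasis K n m) = ∏ k, (C (φ k (m k)) * X k ^ m k) := by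
  rw [toPoly_tBasis, Finset.prod_mul_distrib, ← map_prod, monomial_eq,
    Finsupp.prod_fintype _ _ (fun _ => pow_zero _)]
  rfl

lemma coeff_toPoly (x : TPow K n) (d : Fin n →₀ ℕ) :
    coeff d (toPoly φ hφ x) = (∏ k, φ k (d k)) * (tBasis K n).repr x d := by
  have : (lcoeff K d) ∘ₗ (toPoly φ hφ).toLinearMap =
      (∏ k, φ k (d k)) • (tBasis K n).coord (d : Fin n → ℕ) := by
    refine (tBasis K n).ext fun m => ?_
    simp only [LinearMap.comp_apply, LinearEquiv.coe_coe, LinearMap.smul_apply,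
      Module.Basis.coord_apply, Module.Basis.repr_self, toPoly_tBasis, lcoeff_apply,
      coeff_monomial, Finsupp.single_apply, smul_eq_mul]
    by_cases h : m = d
    · subst h
      simp
    · rw [if_neg h, if_neg, mul_zero]
      rintro rfl
      exact h rfl
  exact LinearMap.congr_fun this x

lemma atSite_tBasis (k : Fin n) (A : Module.End K (ℕ →₀ K)) (m : Fin n → ℕ) (b : ℕ) (c : K)
    (hA : A (Finsupp.single (m k) 1) = c • Finsupp.single b 1) :
    atSite k A (tBasis K n m) = c • tBasis K n (Function.update m k b) := by
  have h := map_tBasis (fun j => if j = k then A else LinearMap.id) m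
    (Function.update m k b) (fun j => if j = k then c else 1) (by
      intro j
      by_cases hj : j = k
      · subst hj; simp [hA]
      · simp [hj])
  rw [Finset.prod_ite_eq' Finset.univ k fun _ => c, if_pos (Finset.mem_univ _)] at h
  exact h

lemma toPoly_tBasis_update (k : Fin n) (m : Fin n → ℕ) (b : ℕ) :
    toPoly φ hφ (tBasis K n (Function.update m k b)) =
      C (φ k b) * X k ^ b * ∏ j ∈ Finset.univ.erase k, (C (φ j (m j)) * X j ^ m j) := by
  rw [toPoly_tBasis_eq_prod, ← Finset.mul_prod_erase _ _ (Finset.mem_univ k),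
    Function.update_self]
  congr 1
  refine Finset.prod_congr rfl fun j hj => ?_
  rw [Function.update_of_ne (Finset.ne_of_mem_erase hj)]

lemma toPoly_tBasis_eq_mul (k : Fin n) (m : Fin n → ℕ) :
    toPoly φ hφ (tBasis K n m) =
      C (φ k (m k)) * X k ^ m k * ∏ j ∈ Finset.univ.erase k, (C (φ j (m j)) * X j ^ m j) := by
  rw [← toPoly_tBasis_update φ hφ, Function.update_eq_self]

lemma toPoly_atSite_raise (k : Fin n) (A : Module.End K (ℕ →₀ K)) (a : ℕ → K) (d : K)
    (hA : ∀ m, A (Finsupp.single m 1) = a m • Finsupp.single (m + 1) 1)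
    (ha : ∀ m, a m * φ k (m + 1) = φ k m * d) (x : TPow K n) :
    toPoly φ hφ (atSite k A x) = C d * X k * toPoly φ hφ x := by
  have : (toPoly φ hφ).toLinearMap ∘ₗ atSite k A =
      LinearMap.mulLeft K (C d * X k) ∘ₗ (toPoly φ hφ).toLinearMap := by
    refine (tBasis K n).ext fun m => ?_
    simp only [LinearMap.comp_apply, LinearEquiv.coe_coe, LinearMap.mulLeft_apply]
    rw [atSite_tBasis k A m _ _ (hA _), map_smul, toPoly_tBasis_update,
      toPoly_tBasis_eq_mul φ hφ k m]
    have hC := congrArg (C (σ := Fin n)) (ha (m k))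
    simp only [C_mul] at hC
    simp only [MvPolynomial.smul_eq_C_mul, pow_succ]
    linear_combination (X k ^ m k * X k *
      ∏ j ∈ Finset.univ.erase k, (C (φ j (m j)) * X j ^ m j)) * hC
  exact LinearMap.congr_fun this x

lemma pderiv_prod_eq_zero (k : Fin n) (s : Finset (Fin n)) (hk : k ∉ s) (c : Fin n → K)
    (m : Fin n → ℕ) : pderiv k (∏ j ∈ s, (C (c j) * X j ^ m j)) = 0 := by
  induction s using Finset.induction_on with
  | empty => simp
  | insert a s ha ih =>
    rw [Finset.mem_insert, not_or] at hk
    rw [Finset.prod_insert ha, Derivation.leibniz, ih hk.2, Derivation.leibniz, pderiv_C,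
      Derivation.leibniz_pow, pderiv_X_of_ne (Ne.symm hk.1)]
    simp

lemma toPoly_atSite_lower (k : Fin n) (A : Module.End K (ℕ →₀ K)) (a : ℕ → K) (d : K)
    (hA : ∀ m, A (Finsupp.single m 1) = a m • Finsupp.single (m - 1) 1)
    (ha : ∀ m, a m * φ k (m - 1) = φ k m * m * d) (x : TPow K n) :
    toPoly φ hφ (atSite k A x) = d • pderiv k (toPoly φ hφ x) := by
  have : (toPoly φ hφ).toLinearMap ∘ₗ atSite k A =
      (d • (pderiv k : Derivation K (MvPolynomial (Fin n) K) _).toLinearMap) ∘ₗ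
        (toPoly φ hφ).toLinearMap := by
    refine (tBasis K n).ext fun m => ?_
    simp only [LinearMap.comp_apply, LinearEquiv.coe_coe, LinearMap.smul_apply]
    change _ = d • pderiv k _
    rw [atSite_tBasis k A m _ _ (hA _), map_smul, toPoly_tBasis_update,
      toPoly_tBasis_eq_mul φ hφ k m]
    have hC := congrArg (C (σ := Fin n)) (ha (m k))
    simp only [C_mul, map_natCast] at hC
    rw [Derivation.leibniz, pderiv_prod_eq_zero _ _ (Finset.notMem_erase _ _), Derivation.leibniz,
      Derivation.leibniz_pow, pderiv_C, pderiv_X_self]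
    simp only [mul_one, MvPolynomial.smul_eq_C_mul, smul_eq_mul, nsmul_eq_mul, mul_zero,
      add_zero, zero_add]
    linear_combination (X k ^ (m k - 1) *
      ∏ j ∈ Finset.univ.erase k, (C (φ j (m j)) * X j ^ m j)) * hC
  exact LinearMap.congr_fun this x

/-- `Δ^{(n)}` of a lowering operator is a multiple of the infinitesimal translation. -/
lemma toPoly_skewPrimitive (l r e : K) (A : Module.End K (ℕ →₀ K)) (a : ℕ → K) (d : Fin n → K)
    (hA : ∀ m, A (Finsupp.single m 1) = a m • Finsupp.single (m - 1) 1)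
    (ha : ∀ k m, a m * φ k (m - 1) = φ k m * m * d k)
    (he : ∀ k : Fin n, l ^ (k : ℕ) * r ^ (n - 1 - (k : ℕ)) * d k = e) (x : TPow K n) :
    toPoly φ hφ (skewPrimitive n (l • LinearMap.id) A (r • LinearMap.id) x) =
      e • transl K n (toPoly φ hφ x) := by
  rw [skewPrimitive_smul_id, LinearMap.sum_apply, map_sum, transl_eq_sum, Finset.smul_sum]
  refine Finset.sum_congr rfl fun k _ => ?_
  rw [LinearMap.smul_apply, map_smul, toPoly_atSite_lower φ hφ k A a (d k) hA (ha k), smul_smul,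
    he]

lemma isHomogeneous_toPoly_iff (x : TPow K n) (N : ℕ) :
    (toPoly φ hφ x).IsHomogeneous N ↔
      ∀ m : Fin n → ℕ, ∑ k, m k ≠ N → (tBasis K n).repr x m = 0 := by
  constructor
  · intro h m hm
    have h1 := coeff_toPoly φ hφ x (Finsupp.equivFunOnFinite.symm m)
    rw [h.coeff_eq_zero (by rwa [Finsupp.degree_eq_sum])] at h1
    have h2 := mul_eq_zero.1 h1.symm
    exact h2.resolve_left (Finset.prod_ne_zero_iff.2 fun k _ => hφ _ _)
  · intro h d hd
    by_contra hne
    refine hd ?_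
    rw [coeff_toPoly, h, mul_zero]
    rwa [← Finsupp.degree_eq_sum, Finsupp.degree_eq_weight_one]

end ToPoly

section Substitutions

variable {K : Type} [Field K] {n : ℕ}

lemma algHom_prod_of_fixed (F : MvPolynomial (Fin n) K →ₐ[K] MvPolynomial (Fin n) K)
    (s : Finset (Fin n)) (h : ∀ j ∈ s, F (X j) = X j) (c : Fin n → K) (m : Fin n → ℕ) :
    F (∏ j ∈ s, (C (c j) * X j ^ m j)) = ∏ j ∈ s, (C (c j) * X j ^ m j) := by
  rw [map_prod]
  refine Finset.prod_congr rfl fun j hj => ?_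
  rw [map_mul, map_pow, algHom_C, h j hj]
  rfl

/-- The transvection `u_i ↦ u_i + κ u_{i+1}`. -/
def shear (κ : K) (i : Fin (n - 1)) : MvPolynomial (Fin n) K →ₐ[K] MvPolynomial (Fin n) K :=
  aeval fun k => if k = lft i then X (lft i) + C κ * X (rgt i) else X k

/-- The rescaling of `u_i` and `u_{i+1}` by `t`. -/
def rescale (t : K) (i : Fin (n - 1)) : MvPolynomial (Fin n) K →ₐ[K] MvPolynomial (Fin n) K :=
  aeval fun k => if k = lft i ∨ k = rgt i then C t * X k else X k

/-- The flip of `u_i` and `u_{i+1}`, rescaled by `t`. -/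
def flip (t : K) (i : Fin (n - 1)) : MvPolynomial (Fin n) K →ₐ[K] MvPolynomial (Fin n) K :=
  aeval fun k => if k = lft i then C t * X (rgt i) else
    if k = rgt i then C t⁻¹ * X (lft i) else X k

lemma burau_eq_comp {t : K} (ht : t ≠ 0) (i : Fin (n - 1)) (p : MvPolynomial (Fin n) K) :
    burau (t ^ 2) i p = flip t i (rescale t i (shear (1 - t ^ 2) i p)) := by
  have hC : (C t * C t⁻¹ : MvPolynomial (Fin n) K) = 1 := by
    rw [← C_mul, mul_inv_cancel₀ ht, C_1]
  have hlr := (lft_ne_rgt i).symm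
  have : burau (t ^ 2) i = (flip t i).comp ((rescale t i).comp (shear (1 - t ^ 2) i)) := by
    refine algHom_ext fun k => ?_
    simp only [AlgHom.comp_apply]
    by_cases h1 : k = lft i
    · subst h1
      simp only [burau_lft, shear, rescale, flip, aeval_X, if_pos, hlr, if_false, map_add, map_mul,
        true_or, or_true, algHom_C, algebraMap_eq]
      simp only [C_sub, C_pow, C_1]
      linear_combination (-(1 - C t ^ 2) * X (lft i)) * hC
    by_cases h2 : k = rgt i
    · subst h2
      simp only [burau_rgt, shear, rescale, flip, aeval_X, if_pos, hlr, if_false, map_mul,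
        or_true, algHom_C, algebraMap_eq]
      linear_combination (- X (lft i)) * hC
    · simp [burau_of_ne _ i h1 h2, shear, rescale, flip, h1, h2]
  exact AlgHom.congr_fun this p

/-- The iterates of `κ u_{i+1} ∂/∂u_i`. -/
lemma iterate_pderiv (κ : K) (i : Fin (n - 1)) (a : ℕ) (R : MvPolynomial (Fin n) K)
    (hR : pderiv (lft i) R = 0) (N : Module.End K (MvPolynomial (Fin n) K))
    (hN : ∀ p, N p = C κ * X (rgt i) * pderiv (lft i) p) (k : ℕ) :
    (N ^ k) (X (lft i) ^ a * R) =
      (a.descFactorial k : MvPolynomial (Fin n) K) *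
        ((C κ * X (rgt i)) ^ k * X (lft i) ^ (a - k) * R) := by
  induction k with
  | zero => simp
  | succ k ih =>
    have hr : pderiv (lft i) (X (rgt i) : MvPolynomial (Fin n) K) = 0 :=
      pderiv_X_of_ne (lft_ne_rgt i).symm
    rw [pow_succ', Module.End.mul_apply, ih, hN, Derivation.leibniz, Derivation.leibniz,
      Derivation.leibniz, Derivation.leibniz_pow, Derivation.leibniz_pow, Derivation.leibniz, hR,
      hr, pderiv_C, pderiv_X_self, Nat.descFactorial_succ, Derivation.map_natCast, Nat.sub_add_eq]
    simp only [smul_eq_mul, nsmul_eq_mul, Nat.cast_mul]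
    ring

variable (φ : Fin n → ℕ → K) (hφ : ∀ k a, φ k a ≠ 0)

/-- The exponential of `κ u_{i+1} ∂/∂u_i` is a transvection. -/
lemma toPoly_exp [CharZero K] (κ : K) (i : Fin (n - 1)) (N : Module.End K (TPow K n))
    (hN : ∀ x, toPoly φ hφ (N x) = C κ * X (rgt i) * pderiv (lft i) (toPoly φ hφ x))
    (x : TPow K n) :
    toPoly φ hφ (((tBasis K n).constr K fun m => ∑ k ∈ Finset.range (m (lft i) + 1),
      ((k.factorial : K)⁻¹) • (N ^ k) (tBasis K n m)) x) = shear κ i (toPoly φ hφ x) := by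
  have : (toPoly φ hφ).toLinearMap ∘ₗ ((tBasis K n).constr K fun m =>
      ∑ k ∈ Finset.range (m (lft i) + 1), ((k.factorial : K)⁻¹) • (N ^ k) (tBasis K n m)) =
      (shear κ i).toLinearMap ∘ₗ (toPoly φ hφ).toLinearMap := by
    refine (tBasis K n).ext fun m => ?_
    simp only [LinearMap.comp_apply, LinearEquiv.coe_coe, AlgHom.toLinearMap_apply,
      Module.Basis.constr_basis, map_sum, map_smul]
    set N' : Module.End K (MvPolynomial (Fin n) K) := (toPoly φ hφ).conj N with hN'
    have hN'p : ∀ p, N' p = C κ * X (rgt i) * pderiv (lft i) p := by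
      intro p
      rw [hN', LinearEquiv.conj_apply_apply, hN, LinearEquiv.apply_symm_apply]
    have hpow : ∀ k y, toPoly φ hφ ((N ^ k) y) = (N' ^ k) (toPoly φ hφ y) := by
      intro k y
      induction k with
      | zero => rfl
      | succ k ih =>
        rw [pow_succ', pow_succ', Module.End.mul_apply, Module.End.mul_apply, ← ih, hN'p, hN]
    simp only [hpow]
    rw [toPoly_tBasis_eq_mul φ hφ (lft i) m]
    set R := ∏ j ∈ Finset.univ.erase (lft i), (C (φ j (m j)) * X j ^ m j) with hRdef
    have hR : pderiv (lft i) R = 0 := pderiv_prod_eq_zero _ _ (Finset.notMem_erase _ _) _ _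
    have hs : shear κ i R = R := algHom_prod_of_fixed _ _
      (fun j hj => by simp [shear, Finset.ne_of_mem_erase hj]) _ _
    rw [map_mul, map_mul, map_pow, hs, algHom_C, algebraMap_eq]
    have hx : shear κ i (X (lft i)) = C κ * X (rgt i) + X (lft i) := by
      simp [shear, add_comm]
    rw [hx, add_pow, Finset.mul_sum, Finset.sum_mul]
    refine Finset.sum_congr rfl fun k _ => ?_
    have hsm : C (φ (lft i) (m (lft i))) * X (lft i) ^ m (lft i) * R =
        φ (lft i) (m (lft i)) • (X (lft i) ^ m (lft i) * R) := by
      rw [MvPolynomial.smul_eq_C_mul, mul_assoc]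
    rw [hsm, map_smul, iterate_pderiv κ i _ R hR N' hN'p, Nat.descFactorial_eq_factorial_mul_choose]
    have hf : (C ((k.factorial : K)⁻¹) * (k.factorial : MvPolynomial (Fin n) K)) = 1 := by
      rw [← map_natCast (C : K →+* MvPolynomial (Fin n) K), ← C_mul, inv_mul_cancel₀, C_1]
      exact_mod_cast k.factorial_ne_zero
    simp only [MvPolynomial.smul_eq_C_mul, Nat.cast_mul]
    linear_combination (C (φ (lft i) (m (lft i))) * ((C κ * X (rgt i)) ^ k *
      X (lft i) ^ (m (lft i) - k) * ((m (lft i)).choose k : MvPolynomial (Fin n) K) * R)) * hf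
  exact LinearMap.congr_fun this x

lemma toPoly_rescale (t e : K) (i : Fin (n - 1)) (z : (Fin n → ℕ) → K)
    (hz : ∀ m, z m = e * t ^ (m (lft i) + m (rgt i))) (x : TPow K n) :
    toPoly φ hφ ((tBasis K n).constr K (fun m => z m • tBasis K n m) x) =
      e • rescale t i (toPoly φ hφ x) := by
  have : (toPoly φ hφ).toLinearMap ∘ₗ ((tBasis K n).constr K fun m => z m • tBasis K n m) =
      (e • (rescale t i).toLinearMap) ∘ₗ (toPoly φ hφ).toLinearMap := by
    refine (tBasis K n).ext fun m => ?_
    simp only [LinearMap.comp_apply, LinearEquiv.coe_coe, AlgHom.toLinearMap_apply,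
      Module.Basis.constr_basis, map_smul, LinearMap.smul_apply]
    rw [hz, mul_smul]
    congr 1
    rw [toPoly_tBasis_eq_prod, map_prod, MvPolynomial.smul_eq_C_mul, C_pow]
    have hF : ∀ j, rescale t i (C (φ j (m j)) * X j ^ m j) =
        (if j = lft i then C t ^ m (lft i) else 1) * (if j = rgt i then C t ^ m (rgt i) else 1) *
          (C (φ j (m j)) * X j ^ m j) := by
      intro j
      have := lft_ne_rgt i
      rw [map_mul, map_pow, algHom_C, algebraMap_eq, rescale, aeval_X]
      by_cases h1 : j = lft i
      · subst h1
        simp [this, mul_pow, mul_left_comm]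
      by_cases h2 : j = rgt i
      · subst h2
        simp [this.symm, mul_pow, mul_left_comm]
      · simp [h1, h2]
    simp only [hF]
    rw [Finset.prod_mul_distrib (g := fun j => C (φ j (m j)) * X j ^ m j),
      Finset.prod_mul_distrib (g := fun j => if j = rgt i then C t ^ m (rgt i) else 1),
      Finset.prod_ite_eq' Finset.univ (lft i) fun _ => C t ^ m (lft i),
      Finset.prod_ite_eq' Finset.univ (rgt i) fun _ => C t ^ m (rgt i),
      if_pos (Finset.mem_univ _), if_pos (Finset.mem_univ _), pow_add]
  exact LinearMap.congr_fun this x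

lemma toPoly_flip (t : K) (i : Fin (n - 1))
    (h1 : ∀ a, φ (rgt i) a = φ (lft i) a * t ^ a)
    (h2 : ∀ a, φ (lft i) a = φ (rgt i) a * t⁻¹ ^ a) (x : TPow K n) :
    toPoly φ hφ (PiTensorProduct.reindex K (fun _ : Fin n => ℕ →₀ K)
      (Equiv.swap (lft i) (rgt i)) x) = flip t i (toPoly φ hφ x) := by
  have : (toPoly φ hφ).toLinearMap ∘ₗ (PiTensorProduct.reindex K (fun _ : Fin n => ℕ →₀ K)
      (Equiv.swap (lft i) (rgt i))).toLinearMap =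
      (flip t i).toLinearMap ∘ₗ (toPoly φ hφ).toLinearMap := by
    refine (tBasis K n).ext fun m => ?_
    simp only [LinearMap.comp_apply, LinearEquiv.coe_coe, AlgHom.toLinearMap_apply]
    have hre : PiTensorProduct.reindex K (fun _ : Fin n => ℕ →₀ K)
        (Equiv.swap (lft i) (rgt i)) (tBasis K n m) =
        tBasis K n fun j => m (Equiv.swap (lft i) (rgt i) j) := by
      rw [tBasis_eq_tprod, tBasis_eq_tprod]
      refine (PiTensorProduct.reindex_tprod _ _).trans ?_
      simp [Equiv.symm_swap]
    rw [hre, toPoly_tBasis_eq_prod, toPoly_tBasis_eq_prod, map_prod,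
      ← Equiv.prod_comp (Equiv.swap (lft i) (rgt i))]
    refine Finset.prod_congr rfl fun j _ => ?_
    simp only [Equiv.swap_apply_self]
    have hlr := (lft_ne_rgt i).symm
    by_cases hj1 : j = lft i
    · subst hj1
      simp only [flip, map_mul, map_pow, aeval_X, if_pos, algHom_C, algebraMap_eq,
        Equiv.swap_apply_left, h1, mul_pow]
      ring
    by_cases hj2 : j = rgt i
    · subst hj2
      simp only [flip, map_mul, map_pow, aeval_X, if_pos, algHom_C, algebraMap_eq,
        Equiv.swap_apply_right, h2, mul_pow, hlr, if_false]
      ring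
    · simp only [flip, map_mul, map_pow, aeval_X, algHom_C, algebraMap_eq, hj1, hj2, if_false,
        Equiv.swap_apply_of_ne_of_ne hj1 hj2]
  exact LinearMap.congr_fun this x

end Substitutions

section Oscillator

variable {q γ : ℝ}

lemma qNumSqrt_mul_self (q γ : ℝ) :
    HOq.qNumSqrt q γ * HOq.qNumSqrt q γ = (HOq.qNum q γ : ℂ) := by
  have h := Complex.cpow_nat_inv_pow (HOq.qNum q γ : ℂ) (two_ne_zero)
  rw [← pow_two, HOq.qNumSqrt, one_div]
  exact_mod_cast h

lemma sub_inv_ne_zero (hq0 : 0 < q) (hq1 : q < 1) : q - q⁻¹ ≠ 0 := by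
  have : 1 < q⁻¹ := (one_lt_inv₀ hq0).2 hq1
  linarith

lemma mul_qNum (hq0 : 0 < q) (hq1 : q < 1) :
    ((q : ℂ) - (q : ℂ)⁻¹) * (HOq.qNum q γ : ℂ) =
      ((q ^ γ : ℝ) : ℂ) - ((q ^ (-γ) : ℝ) : ℂ) := by
  have h := sub_inv_ne_zero hq0 hq1
  have : (q - q⁻¹) * HOq.qNum q γ = q ^ γ - q ^ (-γ) := by
    rw [HOq.qNum, mul_div_cancel₀ _ h]
  exact_mod_cast congrArg (Complex.ofReal) this

lemma qNum_ne_zero (hq0 : 0 < q) (hq1 : q < 1) (hγ : γ ≠ 0) : HOq.qNum q γ ≠ 0 := by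
  rw [HOq.qNum]
  refine div_ne_zero (sub_ne_zero.2 fun h => hγ ?_) (sub_inv_ne_zero hq0 hq1)
  have := Real.rpow_right_inj hq0 hq1.ne |>.1 h
  linarith

lemma qNumSqrt_ne_zero (hq0 : 0 < q) (hq1 : q < 1) (hγ : γ ≠ 0) : HOq.qNumSqrt q γ ≠ 0 := by
  intro h
  have := qNumSqrt_mul_self q γ
  rw [h, zero_mul] at this
  exact qNum_ne_zero hq0 hq1 hγ (by exact_mod_cast this.symm)

lemma qpow_mul_qpow (hq0 : 0 < q) (a b c : ℝ) (h : a + b = c) :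
    ((q ^ a : ℝ) : ℂ) * ((q ^ b : ℝ) : ℂ) = ((q ^ c : ℝ) : ℂ) := by
  rw [← Complex.ofReal_mul, ← Real.rpow_add hq0, h]

lemma qpow_ne_zero (hq0 : 0 < q) (a : ℝ) : ((q ^ a : ℝ) : ℂ) ≠ 0 := by
  exact_mod_cast (Real.rpow_pos_of_pos hq0 a).ne'

lemma qpow_neg_inv (hq0 : 0 < q) (a : ℝ) : ((q ^ (-a) : ℝ) : ℂ)⁻¹ = ((q ^ a : ℝ) : ℂ) := by
  rw [Real.rpow_neg hq0.le, Complex.ofReal_inv, inv_inv]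

lemma qpow_neg_nat (hq0 : 0 < q) (a b : ℝ) (k : ℕ) (h : b = a * k) :
    ((q ^ a : ℝ) : ℂ) ^ k = ((q ^ b : ℝ) : ℂ) := by
  rw [h, Real.rpow_mul_natCast hq0.le, Complex.ofReal_pow]

/-- The normalization of the basis vectors of the oscillator module. -/
def hoWeight (t : ℂ) {n : ℕ} (k : Fin n) (a : ℕ) : ℂ :=
  t ^ ((k : ℕ) * a) * ((Real.sqrt (a.factorial : ℝ) : ℝ) : ℂ)⁻¹

lemma sqrt_factorial_ne_zero (a : ℕ) : ((Real.sqrt (a.factorial : ℝ) : ℝ) : ℂ) ≠ 0 := by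
  have : 0 < Real.sqrt (a.factorial : ℝ) := Real.sqrt_pos.2 (by exact_mod_cast a.factorial_pos)
  exact_mod_cast this.ne'

lemma hoWeight_ne_zero {t : ℂ} (ht : t ≠ 0) {n : ℕ} (k : Fin n) (a : ℕ) : hoWeight t k a ≠ 0 :=
  mul_ne_zero (pow_ne_zero _ ht) (inv_ne_zero (sqrt_factorial_ne_zero a))

lemma sqrt_mul_hoWeight_succ (t : ℂ) {n : ℕ} (k : Fin n) (a : ℕ) :
    ((Real.sqrt (a + 1) : ℝ) : ℂ) * hoWeight t k (a + 1) = hoWeight t k a * t ^ (k : ℕ) := by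
  have h : ((Real.sqrt ((a + 1).factorial : ℝ) : ℝ) : ℂ) =
      ((Real.sqrt (a + 1) : ℝ) : ℂ) * ((Real.sqrt (a.factorial : ℝ) : ℝ) : ℂ) := by
    rw [Nat.factorial_succ, ← Complex.ofReal_mul, ← Real.sqrt_mul (by positivity)]
    push_cast
    rfl
  have h1 : ((Real.sqrt (a + 1) : ℝ) : ℂ) ≠ 0 := by
    have : 0 < Real.sqrt ((a : ℝ) + 1) := Real.sqrt_pos.2 (by positivity)
    exact_mod_cast this.ne'
  have h2 := sqrt_factorial_ne_zero a
  rw [hoWeight, hoWeight, h]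
  field_simp
  ring

lemma sqrt_mul_hoWeight_pred {t : ℂ} (ht : t ≠ 0) {n : ℕ} (k : Fin n) (a : ℕ) :
    ((Real.sqrt a : ℝ) : ℂ) * hoWeight t k (a - 1) = hoWeight t k a * a * t⁻¹ ^ (k : ℕ) := by
  rcases a with _ | a
  · simp
  · have h := sqrt_mul_hoWeight_succ t k a
    have h3 : ((Real.sqrt ((a : ℝ) + 1) : ℝ) : ℂ) * ((Real.sqrt ((a : ℝ) + 1) : ℝ) : ℂ) =
        (a : ℂ) + 1 := by
      rw [← Complex.ofReal_mul, Real.mul_self_sqrt (by positivity)]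
      push_cast
      rfl
    have h4 : t ^ (k : ℕ) * t⁻¹ ^ (k : ℕ) = 1 := by rw [← mul_pow, mul_inv_cancel₀ ht, one_pow]
    rw [Nat.add_sub_cancel]
    push_cast
    rw [← h3]
    linear_combination (-((Real.sqrt ((a : ℝ) + 1) : ℝ) : ℂ) * t⁻¹ ^ (k : ℕ)) * h -
      ((Real.sqrt ((a : ℝ) + 1) : ℝ) : ℂ) * hoWeight t k a * h4

variable (n : ℕ)

/-- The polynomial model of the tensor power of the oscillator module. -/
def hoPoly (γ : ℝ) (hq0 : 0 < q) : TPow ℂ n ≃ₗ[ℂ] MvPolynomial (Fin n) ℂ :=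
  toPoly (hoWeight ((q ^ (-γ) : ℝ) : ℂ)) (hoWeight_ne_zero (qpow_ne_zero hq0 _))

variable {n}

lemma hoPoly_atSite_alphaMinus (hq0 : 0 < q) (k : Fin n) (x : TPow ℂ n) :
    hoPoly n γ hq0 (atSite k (HOq.alphaMinus q γ) x) =
      (HOq.qNumSqrt q γ * ((q ^ γ : ℝ) : ℂ) ^ (k : ℕ)) • pderiv k (hoPoly n γ hq0 x) := by
  refine toPoly_atSite_lower _ _ k _ (fun m => HOq.qNumSqrt q γ * (Real.sqrt m : ℂ)) _ ?_ ?_ x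
  · intro m
    simp [HOq.alphaMinus]
  · intro m
    rw [← qpow_neg_inv hq0 γ]
    linear_combination HOq.qNumSqrt q γ * sqrt_mul_hoWeight_pred (qpow_ne_zero hq0 (-γ)) k m

lemma hoPoly_atSite_alphaPlus (hq0 : 0 < q) (k : Fin n) (x : TPow ℂ n) :
    hoPoly n γ hq0 (atSite k (HOq.alphaPlus q γ) x) =
      C (HOq.qNumSqrt q γ * ((q ^ (-γ) : ℝ) : ℂ) ^ (k : ℕ)) * X k * hoPoly n γ hq0 x := by
  refine toPoly_atSite_raise _ _ k _ (fun m => HOq.qNumSqrt q γ * (Real.sqrt (m + 1) : ℂ)) _ ?_ ?_ x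
  · intro m
    simp [HOq.alphaPlus]
  · intro m
    linear_combination HOq.qNumSqrt q γ * sqrt_mul_hoWeight_succ ((q ^ (-γ) : ℝ) : ℂ) k m

/-- The linear form by which `𝒪_i` multiplies, up to the factor `[γ]^{1/2}`. -/
def oForm (q γ : ℝ) {n : ℕ} (i : Fin (n - 1)) : MvPolynomial (Fin n) ℂ :=
  C (((q ^ (-1 / 2 * γ) : ℝ) : ℂ) * ((q ^ (-γ) : ℝ) : ℂ) ^ (i : ℕ)) * stepDiff ℂ i

lemma id_mul (A : Module.End ℂ (ℕ →₀ ℂ)) : LinearMap.id * A = A := rfl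

lemma hoPoly_opO (hq0 : 0 < q) (hq1 : q < 1) (hγ : γ ≠ 0) (i : Fin (n - 1)) (x : TPow ℂ n) :
    hoPoly n γ hq0 (HOq.opO q γ i x) =
      C (HOq.qNumSqrt q γ) * oForm q γ i * hoPoly n γ hq0 x := by
  have hν := qNumSqrt_ne_zero hq0 hq1 hγ
  rw [HOq.opO, atPair_eq_mul, atPair_eq_mul, HOq.qGam, HOq.qGam, HOq.invSqrtGam, HOq.sqrtGam]
  simp only [atSite_smul, atSite_id, smul_mul_assoc, id_mul, mul_smul_comm,
    one_mul, mul_one, LinearMap.sub_apply, LinearMap.smul_apply, map_sub, map_smul,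
    hoPoly_atSite_alphaPlus]
  have h1 : ((q ^ (1 / 2 * γ) : ℝ) : ℂ) * ((q ^ (-γ) : ℝ) : ℂ) = ((q ^ (-1 / 2 * γ) : ℝ) : ℂ) :=
    qpow_mul_qpow hq0 _ _ _ (by ring)
  have h2 : (C (HOq.qNumSqrt q γ) * C (HOq.qNumSqrt q γ)⁻¹ : MvPolynomial (Fin n) ℂ) = 1 := by
    rw [← C_mul, mul_inv_cancel₀ hν, C_1]
  have hl : (lft i : ℕ) = i := rfl
  have hr : (rgt i : ℕ) = i + 1 := rfl
  rw [oForm, stepDiff, ← h1, hl, hr]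
  simp only [MvPolynomial.smul_eq_C_mul, C_mul, C_pow, pow_succ]
  linear_combination (C (HOq.qNumSqrt q γ) * C ((q ^ (1 / 2 * γ) : ℝ) : ℂ) *
    C ((q ^ (-γ) : ℝ) : ℂ) * C ((q ^ (-γ) : ℝ) : ℂ) ^ (i : ℕ) * (X (lft i) - X (rgt i)) *
      hoPoly n γ hq0 x) * h2

lemma hoPoly_v0 (hq0 : 0 < q) : hoPoly n γ hq0 (HOq.v0 n) = 1 := by
  rw [HOq.v0, hoPoly, toPoly_tBasis_eq_prod]
  simp [hoWeight]

lemma hoPoly_w (hq0 : 0 < q) (hq1 : q < 1) (hγ : γ ≠ 0) (i j : Fin (n - 1)) :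
    hoPoly n γ hq0 (HOq.w q γ i j) = (HOq.qNum q γ : ℂ) • (oForm q γ i * oForm q γ j) := by
  rw [HOq.w, hoPoly_opO hq0 hq1 hγ, hoPoly_opO hq0 hq1 hγ, hoPoly_v0, MvPolynomial.smul_eq_C_mul,
    ← qNumSqrt_mul_self, C_mul]
  ring

lemma hoPoly_nilPart (hq0 : 0 < q) (hq1 : q < 1) (i : Fin (n - 1)) (x : TPow ℂ n) :
    hoPoly n γ hq0 (HOq.nilPart q γ i x) =
      C (1 - ((q ^ (-γ) : ℝ) : ℂ) ^ 2) * X (rgt i) * pderiv (lft i) (hoPoly n γ hq0 x) := by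
  rw [HOq.nilPart, atPair_eq_mul, atPair_eq_mul, HOq.qGam, HOq.qGam]
  simp only [atSite_smul, atSite_id, smul_mul_assoc, mul_smul_comm, one_mul,
    LinearMap.smul_apply, map_smul, Module.End.mul_apply, hoPoly_atSite_alphaPlus,
    hoPoly_atSite_alphaMinus]
  have hr' : pderiv (lft i) (X (rgt i) : MvPolynomial (Fin n) ℂ) = 0 :=
    pderiv_X_of_ne (lft_ne_rgt i).symm
  rw [Derivation.leibniz, Derivation.leibniz, hr', pderiv_C]
  simp only [mul_zero, add_zero, smul_eq_mul]
  have h1 : ((q ^ (1 / 2 * γ) : ℝ) : ℂ) * ((q ^ (-1 / 2 * γ) : ℝ) : ℂ) = 1 := by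
    rw [qpow_mul_qpow hq0 _ _ 0 (by ring)]
    simp
  have h2 : ((q ^ γ : ℝ) : ℂ) * ((q ^ (-γ) : ℝ) : ℂ) = 1 := by
    rw [qpow_mul_qpow hq0 _ _ 0 (by ring)]
    simp
  have h3 : ((q ^ γ : ℝ) : ℂ) ^ (i : ℕ) * ((q ^ (-γ) : ℝ) : ℂ) ^ (i : ℕ) = 1 := by
    rw [← mul_pow, h2, one_pow]
  have h4 := mul_qNum (γ := γ) hq0 hq1
  rw [← qNumSqrt_mul_self] at h4
  have hl : (lft i : ℕ) = i := rfl
  have hr : (rgt i : ℕ) = i + 1 := rfl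
  rw [hl, hr, pow_succ]
  simp only [MvPolynomial.smul_eq_C_mul, ← mul_assoc, ← C_mul]
  congr 3
  set s := ((q ^ γ : ℝ) : ℂ)
  set t := ((q ^ (-γ) : ℝ) : ℂ)
  set ν := HOq.qNumSqrt q γ
  set h := ((q ^ (1 / 2 * γ) : ℝ) : ℂ)
  set h' := ((q ^ (-1 / 2 * γ) : ℝ) : ℂ)
  linear_combination ((q : ℂ) - (q : ℂ)⁻¹) * ν * ν * s ^ (i : ℕ) * t ^ (i : ℕ) * t * h1 +
    ((q : ℂ) - (q : ℂ)⁻¹) * ν * ν * t * h3 + t * h4 + h2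

lemma hoPoly_sigmaNorm (hq0 : 0 < q) (hq1 : q < 1) (c : ℝ) (i : Fin (n - 1)) (x : TPow ℂ n) :
    hoPoly n γ hq0 (HOq.sigmaNorm q γ c i x) =
      burau (((q ^ (-γ) : ℝ) : ℂ) ^ 2) i (hoPoly n γ hq0 x) := by
  have hr : (rgt i : ℕ) = (lft i : ℕ) + 1 := rfl
  have ht := qpow_ne_zero hq0 (-γ)
  rw [burau_eq_comp ht, HOq.sigmaNorm, HOq.sigma]
  simp only [LinearMap.smul_apply, LinearMap.comp_apply, LinearEquiv.coe_coe, map_smul]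
  have h1 := toPoly_flip (hoWeight ((q ^ (-γ) : ℝ) : ℂ)) (hoWeight_ne_zero ht)
    ((q ^ (-γ) : ℝ) : ℂ) i
    (fun a => by rw [hoWeight, hoWeight, hr]; ring)
    (fun a => by
      have : ((q ^ (-γ) : ℝ) : ℂ) ^ a * ((q ^ (-γ) : ℝ) : ℂ)⁻¹ ^ a = 1 := by
        rw [← mul_pow, mul_inv_cancel₀ ht, one_pow]
      rw [hoWeight, hoWeight, hr, add_mul, pow_add, one_mul]
      linear_combination (-(((q ^ (-γ) : ℝ) : ℂ) ^ ((lft i : ℕ) * a) *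
        ((Real.sqrt (a.factorial : ℝ) : ℝ) : ℂ)⁻¹)) * this)
  have h2 := toPoly_rescale (hoWeight ((q ^ (-γ) : ℝ) : ℂ)) (hoWeight_ne_zero ht)
    ((q ^ (-γ) : ℝ) : ℂ) ((q ^ (-(2 * c * γ)) : ℝ) : ℂ) i
    (fun m => ((q ^ (-((m (lft i) + c) * γ + γ * (m (rgt i) + c))) : ℝ) : ℂ))
    (fun m => by
      rw [qpow_neg_nat hq0 (-γ) (-γ * (m (lft i) + m (rgt i) : ℕ)) _ rfl,
        qpow_mul_qpow hq0 _ _ _ rfl]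
      congr 2
      push_cast
      ring)
  have h3 := toPoly_exp (hoWeight ((q ^ (-γ) : ℝ) : ℂ)) (hoWeight_ne_zero ht)
    (1 - ((q ^ (-γ) : ℝ) : ℂ) ^ 2) i (HOq.nilPart q γ i) (hoPoly_nilPart hq0 hq1 i) x
  have h3' : hoPoly n γ hq0 (HOq.expNilPart q γ i x) = _ := h3
  have h2' : hoPoly n γ hq0 (HOq.cartanPart q γ c i (HOq.expNilPart q γ i x)) = _ := h2 _
  refine (congrArg _ (h1 _)).trans ?_
  change _ • flip _ i (hoPoly n γ hq0 (HOq.cartanPart q γ c i (HOq.expNilPart q γ i x))) = _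
  rw [h2']
  change _ • flip _ i (_ • rescale _ i (hoPoly n γ hq0 (HOq.expNilPart q γ i x))) = _
  rw [h3', map_smul, smul_smul, qpow_mul_qpow hq0 _ _ 0 (by ring), Real.rpow_zero,
    Complex.ofReal_one, one_smul]
  rfl

lemma hoPoly_coprodAlphaMinus (hq0 : 0 < q) (x : TPow ℂ n) :
    hoPoly n γ hq0 (HOq.coprodAlphaMinus q γ n x) =
      (HOq.qNumSqrt q γ * ((q ^ (1 / 2 * γ) : ℝ) : ℂ) ^ (n - 1)) •
        transl ℂ n (hoPoly n γ hq0 x) := by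
  refine toPoly_skewPrimitive _ _ _ _ _ _ (fun m => HOq.qNumSqrt q γ * (Real.sqrt m : ℂ))
    (fun k => HOq.qNumSqrt q γ * ((q ^ γ : ℝ) : ℂ) ^ (k : ℕ)) ?_ ?_ ?_ x
  · intro m
    simp [HOq.alphaMinus]
  · intro k m
    rw [← qpow_neg_inv hq0 γ]
    linear_combination HOq.qNumSqrt q γ * sqrt_mul_hoWeight_pred (qpow_ne_zero hq0 (-γ)) k m
  · intro k
    have h1 : ((q ^ (-1 / 2 * γ) : ℝ) : ℂ) * ((q ^ γ : ℝ) : ℂ) = ((q ^ (1 / 2 * γ) : ℝ) : ℂ) :=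
      qpow_mul_qpow hq0 _ _ _ (by ring)
    have h2 : ((q ^ (1 / 2 * γ) : ℝ) : ℂ) ^ (n - 1) = ((q ^ (1 / 2 * γ) : ℝ) : ℂ) ^ (k : ℕ) *
        ((q ^ (1 / 2 * γ) : ℝ) : ℂ) ^ (n - 1 - k) := by
      rw [← pow_add]
      congr 1
      omega
    have h3 : ((q ^ (-1 / 2 * γ) : ℝ) : ℂ) ^ (k : ℕ) * ((q ^ γ : ℝ) : ℂ) ^ (k : ℕ) =
        ((q ^ (1 / 2 * γ) : ℝ) : ℂ) ^ (k : ℕ) := by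
      rw [← mul_pow, h1]
    rw [h2]
    linear_combination (((q ^ (1 / 2 * γ) : ℝ) : ℂ) ^ (n - 1 - k) * HOq.qNumSqrt q γ) * h3

lemma coprodEps_repr (c : ℝ) (x : TPow ℂ n) (m : Fin n → ℕ) :
    (tBasis ℂ n).repr (HOq.coprodEps c n x) m =
      ((∑ k, m k : ℕ) + n * c) * (tBasis ℂ n).repr x m := by
  have : (tBasis ℂ n).coord m ∘ₗ HOq.coprodEps c n =
      (((∑ k, m k : ℕ) : ℂ) + n * c) • (tBasis ℂ n).coord m := by
    refine (tBasis ℂ n).ext fun m' => ?_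
    have h : HOq.coprodEps c n (tBasis ℂ n m') =
        (((∑ k, m' k : ℕ) : ℂ) + n * c) • tBasis ℂ n m' := by
      rw [HOq.coprodEps, LinearMap.sum_apply]
      have hk : ∀ k : Fin n, atSite k (HOq.eps c) (tBasis ℂ n m') =
          ((m' k : ℂ) + c) • tBasis ℂ n m' := by
        intro k
        rw [atSite_tBasis k _ m' (m' k) ((m' k : ℂ) + c) (by simp [HOq.eps]),
          Function.update_eq_self]
      simp only [hk]
      rw [← Finset.sum_smul, Finset.sum_add_distrib]
      simp
    rw [LinearMap.comp_apply, h, map_smul, LinearMap.smul_apply]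
    simp only [Module.Basis.coord_apply, Module.Basis.repr_self, Finsupp.single_apply]
    split_ifs with h
    · rw [h]
    · simp
  exact LinearMap.congr_fun this x

lemma coprodGam_apply (x : TPow ℂ n) : HOq.coprodGam γ n x = ((n : ℂ) * γ) • x := by
  rw [HOq.coprodGam, LinearMap.sum_apply]
  simp only [HOq.gam, atSite_smul, atSite_id, LinearMap.smul_apply, Module.End.one_apply]
  rw [Finset.sum_const, Finset.card_univ, Fintype.card_fin, ← Nat.cast_smul_eq_nsmul ℂ, smul_smul]

lemma mem_lowestWeightSpace_iff (hq0 : 0 < q) (hq1 : q < 1) (hγ : γ ≠ 0) (c : ℝ) (x : TPow ℂ n) :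
    x ∈ HOq.lowestWeightSpace q γ c n (n * c + 2) ↔ hoPoly n γ hq0 x ∈ quad ℂ n := by
  have hne : HOq.qNumSqrt q γ * ((q ^ (1 / 2 * γ) : ℝ) : ℂ) ^ (n - 1) ≠ 0 :=
    mul_ne_zero (qNumSqrt_ne_zero hq0 hq1 hγ) (pow_ne_zero _ (qpow_ne_zero hq0 _))
  rw [HOq.lowestWeightSpace, HOq.weightSpace, Submodule.mem_inf, Submodule.mem_inf, mem_quad]
  refine and_congr ?_ ?_
  · have hG : x ∈ LinearMap.ker
        (HOq.coprodGam γ n - (((n * γ : ℝ)) : ℂ) • (LinearMap.id : Module.End ℂ (TPow ℂ n))) := by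
      rw [LinearMap.mem_ker, LinearMap.sub_apply, coprodGam_apply, LinearMap.smul_apply]
      simp
    rw [and_iff_right hG, hoPoly, isHomogeneous_toPoly_iff, LinearMap.mem_ker,
      LinearMap.sub_apply, LinearMap.smul_apply, LinearMap.id_apply, sub_eq_zero,
      ← (tBasis ℂ n).repr.injective.eq_iff, Finsupp.ext_iff]
    refine forall_congr' fun m => ?_
    rw [coprodEps_repr, map_smul, Finsupp.smul_apply, smul_eq_mul, ← sub_eq_zero, ← sub_mul,
      mul_eq_zero, or_iff_not_imp_left]
    refine imp_congr (not_congr ?_) Iff.rfl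
    have e : (((∑ k, m k : ℕ) : ℂ) + n * c) - ((n * c + 2 : ℝ) : ℂ) =
        ((∑ k, m k : ℕ) : ℂ) - (2 : ℕ) := by
      push_cast
      ring
    rw [e, sub_eq_zero, Nat.cast_inj]
  · rw [LinearMap.mem_ker, ← (hoPoly n γ hq0).map_eq_zero_iff, hoPoly_coprodAlphaMinus,
      smul_eq_zero, or_iff_right hne]

end Oscillator

section JacksonKerler

variable {K : Type} [Field K] {n : ℕ}

lemma toPoly_tBasis_update_update (φ : Fin n → ℕ → K) (hφ : ∀ k a, φ k a ≠ 0) {l r : Fin n}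
    (hlr : l ≠ r) (m : Fin n → ℕ) (a b : ℕ) :
    toPoly φ hφ (tBasis K n (Function.update (Function.update m l a) r b)) =
      C (φ l a) * X l ^ a * (C (φ r b) * X r ^ b) *
        ∏ j ∈ (Finset.univ.erase r).erase l, (C (φ j (m j)) * X j ^ m j) := by
  rw [toPoly_tBasis_update, ← Finset.mul_prod_erase (Finset.univ.erase r)
    (fun j => C (φ j (Function.update m l a j)) * X j ^ Function.update m l a j)
    (Finset.mem_erase.2 ⟨hlr, Finset.mem_univ _⟩)]
  have : ∏ j ∈ (Finset.univ.erase r).erase l,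
      (C (φ j (Function.update m l a j)) * X j ^ Function.update m l a j) =
      ∏ j ∈ (Finset.univ.erase r).erase l, (C (φ j (m j)) * X j ^ m j) :=
    Finset.prod_congr rfl fun j hj => by
      rw [Function.update_of_ne (Finset.ne_of_mem_erase hj)]
  rw [this]
  simp only [Function.update_self]
  ring

lemma qBinom_one (a b : ℕ) : JK.qBinom (1 : K) a b = a.choose b := by
  induction a generalizing b with
  | zero => cases b <;> simp [JK.qBinom]
  | succ a ih =>
    cases b with
    | zero => simp [JK.qBinom]
    | succ b => simp [JK.qBinom, ih, Nat.choose_succ_succ, add_comm]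

lemma rCoeff_one (s : K) (a b k : ℕ) :
    JK.rCoeff 1 s a b k = s⁻¹ ^ (a + b) * ((k + b).choose b : K) * (s - s⁻¹) ^ k := by
  have : s ^ (-((a : ℤ) + b)) = s⁻¹ ^ (a + b) := by
    rw [zpow_neg, inv_pow]
    exact_mod_cast rfl
  rw [JK.rCoeff, this, qBinom_one]
  simp

/-- The normalization of the basis vectors of the Verma module. -/
def jkWeight (t : K) (k : Fin n) (a : ℕ) : K := t ^ ((k : ℕ) * a) * (a.factorial : K)⁻¹

lemma mem_V_iff (l : ℕ) (x : TPow K n) :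
    x ∈ JK.V K n l ↔ ∀ m : Fin n → ℕ, ∑ k, m k ≠ l → (tBasis K n).repr x m = 0 := by
  have : {x | ∃ m : Fin n → ℕ, ∑ a, m a = l ∧ x = tBasis K n m} =
      tBasis K n '' {m | ∑ a, m a = l} := by
    ext x
    simp [eq_comm]
  rw [JK.V, this, Module.Basis.mem_span_image]
  constructor
  · intro h m hm
    by_contra hne
    exact hm (h (Finsupp.mem_support_iff.2 hne))
  · intro h m hm
    by_contra hne
    exact Finsupp.mem_support_iff.1 hm (h m hne)

variable [CharZero K]

lemma jkWeight_ne_zero {t : K} (ht : t ≠ 0) (k : Fin n) (a : ℕ) : jkWeight t k a ≠ 0 :=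
  mul_ne_zero (pow_ne_zero _ ht) (inv_ne_zero (by exact_mod_cast a.factorial_ne_zero))

variable (n) in
/-- The polynomial model of the tensor power of the Verma module. -/
def jkPoly {s : K} (hs : s ≠ 0) : TPow K n ≃ₗ[K] MvPolynomial (Fin n) K :=
  toPoly (jkWeight s⁻¹) (jkWeight_ne_zero (inv_ne_zero hs))

lemma rCoeff_mul_jkWeight {s : K} (hs : s ≠ 0) (i : Fin (n - 1)) (e b k : ℕ) :
    JK.rCoeff 1 s (k + e) b k * (jkWeight s⁻¹ (lft i) (b + k) * jkWeight s⁻¹ (rgt i) e) =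
      jkWeight s⁻¹ (lft i) (k + e) * jkWeight s⁻¹ (rgt i) b *
        ((1 - s⁻¹ ^ 2) ^ k * (s⁻¹ ^ 2) ^ e * ((k + e).choose k : K)) := by
  have hr : (rgt i : ℕ) = (lft i : ℕ) + 1 := rfl
  have h1 : (((k + b).choose k : K)) * k.factorial * b.factorial = (k + b).factorial := by
    rw [Nat.choose_symm_add]
    exact_mod_cast Nat.add_choose_mul_factorial_mul_factorial k b
  have h2 : (((k + e).choose k : K)) * k.factorial * e.factorial = (k + e).factorial := by
    rw [Nat.choose_symm_add]
    exact_mod_cast Nat.add_choose_mul_factorial_mul_factorial k e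
  have hf : ∀ a : ℕ, (a.factorial : K) ≠ 0 := fun a => by exact_mod_cast a.factorial_ne_zero
  have h3 : (1 - s⁻¹ ^ 2) ^ k = (s - s⁻¹) ^ k * s⁻¹ ^ k := by
    rw [← mul_pow]
    congr 1
    field_simp
  have e1 : ((k + b).choose b : K) * ((k + b).factorial : K)⁻¹ =
      (k.factorial : K)⁻¹ * (b.factorial : K)⁻¹ := by
    have := hf k
    have := hf b
    rw [← Nat.choose_symm_add]
    have := hf (k + b)
    field_simp
    linear_combination h1
  have e2 : ((k + e).choose k : K) * ((k + e).factorial : K)⁻¹ =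
      (k.factorial : K)⁻¹ * (e.factorial : K)⁻¹ := by
    have := hf k
    have := hf e
    have := hf (k + e)
    field_simp
    linear_combination h2
  rw [rCoeff_one, jkWeight, jkWeight, jkWeight, jkWeight, hr, h3, add_comm b k]
  set t := s⁻¹
  calc _ = (t ^ (k + e + b) * (s - t) ^ k * t ^ ((lft i : ℕ) * (k + b)) *
        t ^ (((lft i : ℕ) + 1) * e)) * (e.factorial : K)⁻¹ *
          (((k + b).choose b : K) * ((k + b).factorial : K)⁻¹) := by ring
    _ = (t ^ ((lft i : ℕ) * (k + e)) * t ^ (((lft i : ℕ) + 1) * b) * (s - t) ^ k * t ^ k *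
          (t ^ 2) ^ e) * (b.factorial : K)⁻¹ *
          (((k + e).choose k : K) * ((k + e).factorial : K)⁻¹) := by
        rw [e1, e2]
        ring
    _ = _ := by ring

lemma jkPoly_sigma {s : K} (hs : s ≠ 0) (i : Fin (n - 1)) (x : TPow K n) :
    jkPoly n hs (JK.sigma 1 s i x) = burau (s⁻¹ ^ 2) i (jkPoly n hs x) := by
  have : (jkPoly n hs).toLinearMap ∘ₗ JK.sigma 1 s i =
      (burau (s⁻¹ ^ 2) i).toLinearMap ∘ₗ (jkPoly n hs).toLinearMap := by
    refine (tBasis K n).ext fun m => ?_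
    have hlr := lft_ne_rgt i
    simp only [LinearMap.comp_apply, LinearEquiv.coe_coe, AlgHom.toLinearMap_apply, JK.sigma,
      Module.Basis.constr_basis, map_sum, map_smul, jkPoly, toPoly_tBasis_update_update _ _ hlr]
    have hm := toPoly_tBasis_update_update (jkWeight s⁻¹) (jkWeight_ne_zero (inv_ne_zero hs)) hlr m
      (m (lft i)) (m (rgt i))
    rw [Function.update_eq_self, Function.update_eq_self] at hm
    rw [hm]
    set R := ∏ j ∈ (Finset.univ.erase (rgt i)).erase (lft i),
      (C (jkWeight s⁻¹ j (m j)) * X j ^ m j) with hR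
    have hfix : burau (s⁻¹ ^ 2) i R = R := algHom_prod_of_fixed _ _ (fun j hj => by
      rw [Finset.mem_erase, Finset.mem_erase] at hj
      exact burau_of_ne _ _ hj.1 hj.2.1) _ _
    simp only [map_mul, map_pow, burau_C, burau_lft, burau_rgt, hfix]
    rw [add_pow, Finset.mul_sum, Finset.sum_mul, Finset.sum_mul]
    refine Finset.sum_congr rfl fun k hk => ?_
    rw [Finset.mem_range] at hk
    obtain ⟨e, he⟩ := Nat.exists_eq_add_of_le (Nat.le_of_lt_succ hk)
    rw [he, Nat.add_sub_cancel_left]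
    have key := congrArg (C (σ := Fin n)) (rCoeff_mul_jkWeight hs i e (m (rgt i)) k)
    simp only [C_mul, C_pow, map_natCast] at key
    simp only [MvPolynomial.smul_eq_C_mul, mul_pow]
    linear_combination (X (lft i) ^ (m (rgt i) + k) * X (rgt i) ^ e * R) * key
  exact LinearMap.congr_fun this x

lemma jkPoly_coprodE {s : K} (hs : s ≠ 0) (x : TPow K n) :
    jkPoly n hs (JK.coprodE 1 s n x) = s ^ (n - 1) • transl K n (jkPoly n hs x) := by
  have hK : JK.opK 1 s = s • (LinearMap.id : Module.End K (ℕ →₀ K)) := by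
    refine Finsupp.basisSingleOne.ext fun m => ?_
    simp [JK.opK]
  have h1 : (LinearMap.id : Module.End K (ℕ →₀ K)) = (1 : K) • LinearMap.id := (one_smul _ _).symm
  rw [JK.coprodE, hK, h1]
  rw [smul_smul, mul_one]
  refine toPoly_skewPrimitive _ _ _ _ _ _ (fun m => if m = 0 then 0 else 1)
    (fun k => s ^ (k : ℕ)) ?_ ?_ ?_ x
  · intro m
    by_cases h : m = 0 <;> simp [JK.opE, h]
  · intro k m
    rcases m with _ | m
    · simp
    · have h2 : s⁻¹ ^ (k : ℕ) * s ^ (k : ℕ) = 1 := by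
        rw [← mul_pow, inv_mul_cancel₀ hs, one_pow]
      have h3 : ((m + 1).factorial : K)⁻¹ * ((m + 1 : ℕ) : K) = (m.factorial : K)⁻¹ := by
        have : (m.factorial : K) ≠ 0 := by exact_mod_cast m.factorial_ne_zero
        have : ((m : K) + 1) ≠ 0 := by exact_mod_cast m.succ_ne_zero
        rw [Nat.factorial_succ]
        push_cast
        field_simp
      rw [if_neg m.succ_ne_zero, Nat.add_sub_cancel, jkWeight, jkWeight, mul_add, pow_add, mul_one]
      linear_combination (-(s⁻¹ ^ ((k : ℕ) * m) * s⁻¹ ^ (k : ℕ) * s ^ (k : ℕ))) * h3 -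
        s⁻¹ ^ ((k : ℕ) * m) * (m.factorial : K)⁻¹ * h2
  · intro k
    rw [one_pow, one_mul, ← pow_add]
    congr 1
    omega

lemma mem_W_iff {s : K} (hs : s ≠ 0) (x : TPow K n) :
    x ∈ JK.W 1 s n 2 ↔ jkPoly n hs x ∈ quad K n := by
  rw [JK.W, Submodule.mem_inf, mem_quad, jkPoly, isHomogeneous_toPoly_iff, mem_V_iff]
  refine and_congr Iff.rfl ?_
  change _ ↔ transl K n (jkPoly n hs x) = 0
  rw [LinearMap.mem_ker, ← (jkPoly n hs).map_eq_zero_iff, jkPoly_coprodE, smul_eq_zero,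
    or_iff_right (pow_ne_zero _ hs)]

lemma jkPoly_vec {s : K} (hs : s ≠ 0) {j k : Fin n} (hjk : j ≠ k) :
    jkPoly n hs (JK.vec 1 s j k) =
      C (-2⁻¹ * s⁻¹ ^ ((j : ℕ) + (k : ℕ))) * (X j - X k) ^ 2 := by
  have e1 : (Pi.single j 1 + Pi.single k 1 : Fin n → ℕ) =
      Function.update (Function.update (0 : Fin n → ℕ) j 1) k 1 := by
    funext a
    by_cases h1 : a = k
    · subst h1; simp [hjk.symm]
    by_cases h2 : a = j
    · subst h2; simp [h1]
    · simp [h1, h2]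
  have e2 : ∀ a : Fin n, jkPoly n hs (tBasis K n (Pi.single a 2)) =
      C (2⁻¹ * (s⁻¹ ^ (a : ℕ)) ^ 2) * X a ^ 2 := by
    intro a
    rw [Pi.single, jkPoly, toPoly_tBasis_update]
    simp [jkWeight, pow_mul, mul_comm]
  have h0 : ∀ a : ℕ, s⁻¹ ^ a * s ^ a = 1 := fun a => by rw [← mul_pow, inv_mul_cancel₀ hs, one_pow]
  have z1 : ∀ a b : Fin n, s ^ ((a : ℤ) - (b : ℤ)) = s ^ (a : ℕ) * s⁻¹ ^ (b : ℕ) := by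
    intro a b
    rw [zpow_sub₀ hs, zpow_natCast, zpow_natCast, inv_pow, div_eq_mul_inv]
  rw [JK.vec, map_sub, map_sub, map_smul, map_smul, e2, e2, e1, z1, z1, one_zpow, one_mul]
  rw [jkPoly, toPoly_tBasis_update_update _ _ hjk]
  have hj := congrArg (C (σ := Fin n)) (h0 j)
  have hk := congrArg (C (σ := Fin n)) (h0 k)
  have h2 : (2 * C 2⁻¹ : MvPolynomial (Fin n) K) = 1 := by
    rw [← map_ofNat C 2, ← C_mul, mul_inv_cancel₀ two_ne_zero, C_1]
  simp only [C_mul, C_pow, C_1] at hj hk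
  simp only [jkWeight, Pi.zero_apply, mul_zero, mul_one, pow_zero, Nat.factorial, Nat.cast_one,
    inv_one, C_1, Finset.prod_const_one, pow_one, MvPolynomial.smul_eq_C_mul, pow_add, C_mul,
    C_neg, C_pow]
  linear_combination (-(C s⁻¹ ^ (j : ℕ) * C s⁻¹ ^ (k : ℕ) * X j * X k)) * h2 -
    C s⁻¹ ^ (k : ℕ) * C 2⁻¹ * C s⁻¹ ^ (j : ℕ) * X j ^ 2 * hj -
    C s⁻¹ ^ (j : ℕ) * C 2⁻¹ * C s⁻¹ ^ (k : ℕ) * X k ^ 2 * hk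

end JacksonKerler

section Forms

variable {q γ : ℝ} {n : ℕ}

lemma stepDiff_eq_var {K : Type} [Field K] (i : Fin (n - 1)) :
    stepDiff K i = var K n i - var K n (i + 1) := by
  rw [stepDiff, ← var_coe, ← var_coe]
  rfl

lemma burau_oForm_self (i : Fin (n - 1)) :
    burau (((q ^ (-γ) : ℝ) : ℂ) ^ 2) i (oForm q γ i) =
      -(C ((q ^ (-γ) : ℝ) : ℂ) ^ 2 * oForm q γ i) := by
  rw [oForm, stepDiff_eq_var, map_mul, map_sub, burau_C, burau_var_self, burau_var_succ]
  simp only [C_sub, C_pow, C_1]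
  ring

lemma burau_oForm_adj (i l : Fin (n - 1)) (h : (l : ℕ) = i + 1 ∨ (l : ℕ) + 1 = i) :
    burau (((q ^ (-γ) : ℝ) : ℂ) ^ 2) i (oForm q γ l) =
      oForm q γ l + C ((q ^ (-γ) : ℝ) : ℂ) * oForm q γ i := by
  rw [oForm, oForm, stepDiff_eq_var, stepDiff_eq_var, map_mul, map_sub, burau_C]
  rcases h with h | h
  · rw [h, burau_var_succ, burau_var_of_ne _ _ (by omega) (by omega), pow_succ]
    simp only [C_mul, C_pow]
    ring
  · have hi : var ℂ n (l + 1) = var ℂ n i := by rw [h]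
    rw [hi, burau_var_self, burau_var_of_ne _ _ (by omega) (by omega), ← h, pow_succ]
    simp only [C_mul, C_pow, C_sub, C_1]
    ring

lemma burau_oForm_far (i k : Fin (n - 1)) (h : (k : ℕ) + 1 < i ∨ (i : ℕ) + 1 < k) :
    burau (((q ^ (-γ) : ℝ) : ℂ) ^ 2) i (oForm q γ k) = oForm q γ k := by
  rw [oForm, stepDiff_eq_var, map_mul, map_sub, burau_C,
    burau_var_of_ne _ _ (by omega) (by omega), burau_var_of_ne _ _ (by omega) (by omega)]

lemma oForm_mul_mem (i j : Fin (n - 1)) : oForm q γ i * oForm q γ j ∈ quad ℂ n := by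
  have := Submodule.smul_mem _ ((((q ^ (-1 / 2 * γ) : ℝ) : ℂ) * ((q ^ (-γ) : ℝ) : ℂ) ^ (i : ℕ)) *
    (((q ^ (-1 / 2 * γ) : ℝ) : ℂ) * ((q ^ (-γ) : ℝ) : ℂ) ^ (j : ℕ)))
    (stepDiff_mul_mem (K := ℂ) i j)
  convert this using 1
  simp only [oForm, MvPolynomial.smul_eq_C_mul, C_mul]
  ring

lemma oForm_mul (hq0 : 0 < q) (i j : Fin (n - 1)) :
    oForm q γ i * oForm q γ j =
      C (((q ^ (-γ) : ℝ) : ℂ) ^ ((i : ℕ) + j + 1)) * (stepDiff ℂ i * stepDiff ℂ j) := by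
  have h : ((q ^ (-1 / 2 * γ) : ℝ) : ℂ) * ((q ^ (-1 / 2 * γ) : ℝ) : ℂ) = ((q ^ (-γ) : ℝ) : ℂ) :=
    qpow_mul_qpow hq0 _ _ _ (by ring)
  have e : ((q ^ (-γ) : ℝ) : ℂ) ^ ((i : ℕ) + j + 1) = (((q ^ (-1 / 2 * γ) : ℝ) : ℂ) *
      ((q ^ (-1 / 2 * γ) : ℝ) : ℂ)) * ((q ^ (-γ) : ℝ) : ℂ) ^ ((i : ℕ) + j) := by
    rw [h, pow_succ']
  rw [oForm, oForm, e, pow_add]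
  simp only [C_mul, C_pow]
  ring

end Forms

section Restriction

variable {K A B : Type*} [Field K] [AddCommGroup A] [Module K A] [AddCommGroup B] [Module K B]

/-- A linear equivalence restricted to submodules that correspond to each other. -/
def restrictEquiv (e : A ≃ₗ[K] B) (p : Submodule K A) (r : Submodule K B)
    (h : ∀ x, x ∈ p ↔ e x ∈ r) : p ≃ₗ[K] r :=
  e.ofSubmodules p r (by
    ext y
    rw [Submodule.mem_map]
    constructor
    · rintro ⟨x, hx, rfl⟩
      exact (h x).1 hx
    · intro hy
      exact ⟨e.symm y, (h _).2 (by simpa using hy), by simp⟩)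

lemma coe_restrictEquiv (e : A ≃ₗ[K] B) (p : Submodule K A) (r : Submodule K B)
    (h : ∀ x, x ∈ p ↔ e x ∈ r) (x : p) : (restrictEquiv e p r h x : B) = e x := rfl

lemma apply_restrictEquiv_symm (e : A ≃ₗ[K] B) (p : Submodule K A) (r : Submodule K B)
    (h : ∀ x, x ∈ p ↔ e x ∈ r) (y : r) : e ((restrictEquiv e p r h).symm y) = y := by
  rw [← coe_restrictEquiv e p r h, LinearEquiv.apply_symm_apply]

end Restriction

section Action

variable {q γ : ℝ} {n : ℕ} (hq0 : 0 < q) (hq1 : q < 1) (hγ : γ ≠ 0) (c : ℝ)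

/-- The lowest weight space of level two as a space of translation invariant quadratic forms. -/
def hoEquiv : HOq.lowestWeightSpace q γ c n (n * c + 2) ≃ₗ[ℂ] quad ℂ n :=
  restrictEquiv (hoPoly n γ hq0) _ _ (mem_lowestWeightSpace_iff hq0 hq1 hγ c)

/-- The highest weight space `W_{n,2}` as a space of translation invariant quadratic forms. -/
def jkEquiv {s : ℂ} (hs : s ≠ 0) : JK.W (1 : ℂ) s n 2 ≃ₗ[ℂ] quad ℂ n :=
  restrictEquiv (jkPoly n hs) _ _ (mem_W_iff hs)

lemma hoPoly_hoEquiv_symm (y : quad ℂ n) :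
    hoPoly n γ hq0 ((hoEquiv hq0 hq1 hγ c).symm y : TPow ℂ n) = y :=
  apply_restrictEquiv_symm _ _ _ _ y

lemma jkPoly_jkEquiv_symm {s : ℂ} (hs : s ≠ 0) (y : quad ℂ n) :
    jkPoly n hs ((jkEquiv hs).symm y : TPow ℂ n) = y :=
  apply_restrictEquiv_symm _ _ _ _ y

/-- The basis of the lowest weight space that consists of the vectors `w_{i,j}`. -/
def wBasis : Module.Basis {p : Fin (n - 1) × Fin (n - 1) // p.1 ≤ p.2} ℂ
    (HOq.lowestWeightSpace q γ c n (n * c + 2)) :=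
  (basisOfSpan (K := ℂ) (n := n)
    (fun p : {p : Fin (n - 1) × Fin (n - 1) // p.1 ≤ p.2} =>
      (HOq.qNum q γ : ℂ) • ⟨_, oForm_mul_mem (q := q) (γ := γ) p.1.1 p.1.2⟩) (card_pairs n)
    (fun i j hij => by
      have hν : (HOq.qNum q γ : ℂ) ≠ 0 := by exact_mod_cast qNum_ne_zero hq0 hq1 hγ
      have ht : ((q ^ (-γ) : ℝ) : ℂ) ^ ((i : ℕ) + j + 1) ≠ 0 :=
        pow_ne_zero _ (qpow_ne_zero hq0 _)
      have : (⟨_, stepDiff_mul_mem i j⟩ : quad ℂ n) =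
          (((HOq.qNum q γ : ℂ) * ((q ^ (-γ) : ℝ) : ℂ) ^ ((i : ℕ) + j + 1))⁻¹) •
            ((HOq.qNum q γ : ℂ) • ⟨_, oForm_mul_mem (q := q) (γ := γ) i j⟩) := by
        rw [eq_inv_smul_iff₀ (mul_ne_zero hν ht), mul_smul]
        congr 1
        apply Subtype.ext
        rw [Submodule.coe_smul, MvPolynomial.smul_eq_C_mul]
        exact (oForm_mul hq0 i j).symm
      rw [this]
      exact Submodule.smul_mem _ _ (Submodule.subset_span ⟨⟨(i, j), hij⟩, rfl⟩))).map
    (hoEquiv hq0 hq1 hγ c).symm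

lemma hoPoly_wBasis (p : {p : Fin (n - 1) × Fin (n - 1) // p.1 ≤ p.2}) :
    hoPoly n γ hq0 (wBasis hq0 hq1 hγ c p : TPow ℂ n) =
      (HOq.qNum q γ : ℂ) • (oForm q γ p.1.1 * oForm q γ p.1.2) := by
  rw [wBasis, Module.Basis.map_apply, hoPoly_hoEquiv_symm, basisOfSpan_apply]
  rfl

lemma coe_wBasis (p : {p : Fin (n - 1) × Fin (n - 1) // p.1 ≤ p.2}) :
    (wBasis hq0 hq1 hγ c p : TPow ℂ n) = HOq.w q γ p.1.1 p.1.2 := by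
  apply (hoPoly n γ hq0).injective
  rw [hoPoly_wBasis, hoPoly_w hq0 hq1 hγ]

/-- The basis of `W_{n,2}` that consists of the vectors `W_{i,j}`. -/
def vecBasis {s : ℂ} (hs : s ≠ 0) :
    Module.Basis {p : Fin n × Fin n // p.1 < p.2} ℂ (JK.W (1 : ℂ) s n 2) :=
  ((sqDiffBasis (K := ℂ)).isUnitSMul
    (w := fun p => -2⁻¹ * s⁻¹ ^ ((p.1.1 : ℕ) + (p.1.2 : ℕ))) fun _ =>
      (mul_ne_zero (by norm_num) (pow_ne_zero _ (inv_ne_zero hs))).isUnit).map (jkEquiv hs).symm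

lemma coe_vecBasis {s : ℂ} (hs : s ≠ 0) (p : {p : Fin n × Fin n // p.1 < p.2}) :
    (vecBasis hs p : TPow ℂ n) = JK.vec (1 : ℂ) s p.1.1 p.1.2 := by
  apply (jkPoly n hs).injective
  rw [jkPoly_vec hs p.2.ne, vecBasis, Module.Basis.map_apply, jkPoly_jkEquiv_symm,
    Module.Basis.isUnitSMul_apply, Submodule.coe_smul, coe_sqDiffBasis,
    MvPolynomial.smul_eq_C_mul]

variable {Q : ℂ} (hQ : Q ≠ 0)

lemma coe_transport_hoEquiv (h : ((q ^ (-γ) : ℝ) : ℂ) ^ 2 = Q) (i : Fin (n - 1))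
    (x : HOq.lowestWeightSpace q γ c n (n * c + 2)) :
    ((quadRep hQ).transport (hoEquiv hq0 hq1 hγ c).symm (braidGen i) x : TPow ℂ n) =
      HOq.sigmaNorm q γ c i x := by
  subst h
  apply (hoPoly n γ hq0).injective
  rw [Representation.transport_apply, hoPoly_hoEquiv_symm, quadRep_gen,
    hoPoly_sigmaNorm hq0 hq1]
  rfl

lemma coe_transport_jkEquiv {s : ℂ} (hs : s ≠ 0) (h : s⁻¹ ^ 2 = Q) (i : Fin (n - 1))
    (x : JK.W (1 : ℂ) s n 2) :
    ((quadRep hQ).transport (jkEquiv hs).symm (braidGen i) x : TPow ℂ n) =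
      JK.sigma (1 : ℂ) s i x := by
  subst h
  apply (jkPoly n hs).injective
  rw [Representation.transport_apply, jkPoly_jkEquiv_symm, quadRep_gen, jkPoly_sigma]
  rfl

/-- The isomorphism of the lowest weight space of level two with `W_{n,2}`. -/
def hoJkEquiv {s : ℂ} (hs : s ≠ 0) :
    ((quadRep hQ).transport (hoEquiv (n := n) hq0 hq1 hγ c).symm).Equiv
      ((quadRep hQ).transport (jkEquiv hs).symm) :=
  Representation.Equiv.mk
    ((hoEquiv hq0 hq1 hγ c).trans ((LinearEquiv.smulOfNeZero ℂ (quad ℂ n) (HOq.qNum q γ : ℂ)⁻¹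
      (inv_ne_zero (by exact_mod_cast qNum_ne_zero hq0 hq1 hγ))).trans (jkEquiv hs).symm))
    fun g => by
      ext x : 1
      simp [Representation.transport_apply]

lemma jkPoly_hoJkEquiv_wBasis {s : ℂ} (hs : s ≠ 0)
    (p : {p : Fin (n - 1) × Fin (n - 1) // p.1 ≤ p.2}) :
    jkPoly n hs (hoJkEquiv hq0 hq1 hγ c hQ hs (wBasis hq0 hq1 hγ c p) : TPow ℂ n) =
      C (((q ^ (-γ) : ℝ) : ℂ) ^ ((p.1.1 : ℕ) + p.1.2 + 1)) *
        (stepDiff ℂ p.1.1 * stepDiff ℂ p.1.2) := by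
  have hν : (HOq.qNum q γ : ℂ) ≠ 0 := by exact_mod_cast qNum_ne_zero hq0 hq1 hγ
  have h1 : jkPoly n hs (hoJkEquiv hq0 hq1 hγ c hQ hs (wBasis hq0 hq1 hγ c p) : TPow ℂ n) =
      (HOq.qNum q γ : ℂ)⁻¹ • hoPoly n γ hq0 (wBasis hq0 hq1 hγ c p : TPow ℂ n) :=
    jkPoly_jkEquiv_symm hs _
  rw [h1, hoPoly_wBasis, smul_smul, inv_mul_cancel₀ hν, one_smul, oForm_mul hq0]

end Action

end InvQuad

end

open InvQuad

theorem mainTheorem6 (n : ℕ) (q γ c : ℝ) (hq0 : 0 < q) (hq1 : q < 1) (hγ : γ ≠ 0) :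
    -- the representation of `B_n` on the lowest weight space of level two
    ∃ ρ : Representation ℂ (BraidGroup n) (HOq.lowestWeightSpace q γ c n (n * c + 2)),
      (∀ (i : Fin (n - 1)) (x : HOq.lowestWeightSpace q γ c n (n * c + 2)),
        (ρ (braidGen i) x : TPow ℂ n) = HOq.sigmaNorm q γ c i x) ∧
      -- the `w_{i,j}` with `i ≤ j` are a basis, and the dimension is `n (n - 1) / 2`
      (∀ i j : Fin (n - 1), HOq.w q γ i j = HOq.w q γ j i) ∧
      (∃ b : Module.Basis {p : Fin (n - 1) × Fin (n - 1) // p.1 ≤ p.2} ℂ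
            (HOq.lowestWeightSpace q γ c n (n * c + 2)),
        (∀ p, (b p : TPow ℂ n) = HOq.w q γ p.1.1 p.1.2) ∧
        Module.finrank ℂ (HOq.lowestWeightSpace q γ c n (n * c + 2)) = n * (n - 1) / 2 ∧
        -- the change of basis to the Jackson–Kerler representation `W_{n,2}`
        -- (first parameter `1`, second parameter `s = q^γ`)
        ∃ ρJK : Representation ℂ (BraidGroup n) (JK.W (1 : ℂ) ((q ^ γ : ℝ) : ℂ) n 2),
          (∀ (i : Fin (n - 1)) (x : JK.W (1 : ℂ) ((q ^ γ : ℝ) : ℂ) n 2),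
            (ρJK (braidGen i) x : TPow ℂ n) = JK.sigma (1 : ℂ) ((q ^ γ : ℝ) : ℂ) i x) ∧
          (∃ bW : Module.Basis {p : Fin n × Fin n // p.1 < p.2} ℂ
                (JK.W (1 : ℂ) ((q ^ γ : ℝ) : ℂ) n 2),
            ∀ p, (bW p : TPow ℂ n) = JK.vec (1 : ℂ) ((q ^ γ : ℝ) : ℂ) p.1.1 p.1.2) ∧
          ∃ Φ : ρ.Equiv ρJK,
            (∀ (i : Fin (n - 1)),
              (Φ (b ⟨(i, i), le_rfl⟩) : TPow ℂ n) =
                (-2 : ℂ) • JK.vec (1 : ℂ) ((q ^ γ : ℝ) : ℂ) (lft i) (rgt i)) ∧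
            (∀ (i r : Fin (n - 1)) (h : i ≤ r), (i : ℕ) + 1 = r →
              (Φ (b ⟨(i, r), h⟩) : TPow ℂ n) =
                (((q ^ γ : ℝ) : ℂ)⁻¹) • JK.vec (1 : ℂ) ((q ^ γ : ℝ) : ℂ) (lft i) (rgt i)
                  - JK.vec (1 : ℂ) ((q ^ γ : ℝ) : ℂ) (lft i) (rgt r)
                  + ((q ^ γ : ℝ) : ℂ) • JK.vec (1 : ℂ) ((q ^ γ : ℝ) : ℂ) (rgt i) (rgt r)) ∧
            (∀ (i r : Fin (n - 1)) (h : i ≤ r), (i : ℕ) + 2 ≤ r →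
              (Φ (b ⟨(i, r), h⟩) : TPow ℂ n) =
                - JK.vec (1 : ℂ) ((q ^ γ : ℝ) : ℂ) (lft i) (rgt r)
                  + ((q ^ γ : ℝ) : ℂ) • JK.vec (1 : ℂ) ((q ^ γ : ℝ) : ℂ) (rgt i) (rgt r)
                  + (((q ^ γ : ℝ) : ℂ)⁻¹) • JK.vec (1 : ℂ) ((q ^ γ : ℝ) : ℂ) (lft i) (lft r)
                  - JK.vec (1 : ℂ) ((q ^ γ : ℝ) : ℂ) (rgt i) (lft r))) ∧
      -- the explicit formulas; `j`, `k` range over indices that are not `i - 1`, `i`, `i + 1`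
      (∀ i j k : Fin (n - 1),
        (j : ℕ) + 1 < i ∨ (i : ℕ) + 1 < j → (k : ℕ) + 1 < i ∨ (i : ℕ) + 1 < k →
          HOq.sigmaNorm q γ c i (HOq.w q γ j k) = HOq.w q γ j k) ∧
      (∀ i : Fin (n - 1),
        HOq.sigmaNorm q γ c i (HOq.w q γ i i) =
          ((q ^ (-4 * γ) : ℝ) : ℂ) • HOq.w q γ i i) ∧
      (∀ i k : Fin (n - 1), (k : ℕ) + 1 < i ∨ (i : ℕ) + 1 < k →
        HOq.sigmaNorm q γ c i (HOq.w q γ i k) =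
          (-((q ^ (-2 * γ) : ℝ) : ℂ)) • HOq.w q γ i k ∧
        HOq.sigmaNorm q γ c i (HOq.w q γ k i) =
          (-((q ^ (-2 * γ) : ℝ) : ℂ)) • HOq.w q γ k i) ∧
      (∀ i l k : Fin (n - 1), (l : ℕ) = i + 1 ∨ (l : ℕ) + 1 = i →
        (k : ℕ) + 1 < i ∨ (i : ℕ) + 1 < k →
        HOq.sigmaNorm q γ c i (HOq.w q γ l k) =
          ((q ^ (-γ) : ℝ) : ℂ) • HOq.w q γ i k + HOq.w q γ l k ∧
        HOq.sigmaNorm q γ c i (HOq.w q γ k l) =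
          ((q ^ (-γ) : ℝ) : ℂ) • HOq.w q γ k i + HOq.w q γ k l) ∧
      (∀ i l : Fin (n - 1), (l : ℕ) + 1 = i →
        HOq.sigmaNorm q γ c i (HOq.w q γ l i) =
          (-((q ^ (-2 * γ) : ℝ) : ℂ)) •
            (HOq.w q γ l i + ((q ^ (-γ) : ℝ) : ℂ) • HOq.w q γ i i) ∧
        HOq.sigmaNorm q γ c i (HOq.w q γ l l) =
          ((q ^ (-2 * γ) : ℝ) : ℂ) • HOq.w q γ i i +
            (2 * ((q ^ (-γ) : ℝ) : ℂ)) • HOq.w q γ l i + HOq.w q γ l l) ∧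
      (∀ i r : Fin (n - 1), (r : ℕ) = i + 1 →
        HOq.sigmaNorm q γ c i (HOq.w q γ i r) =
          (-((q ^ (-2 * γ) : ℝ) : ℂ)) •
            (HOq.w q γ i r + ((q ^ (-γ) : ℝ) : ℂ) • HOq.w q γ i i) ∧
        HOq.sigmaNorm q γ c i (HOq.w q γ r r) =
          ((q ^ (-2 * γ) : ℝ) : ℂ) • HOq.w q γ i i +
            (2 * ((q ^ (-γ) : ℝ) : ℂ)) • HOq.w q γ i r + HOq.w q γ r r) ∧
      (∀ i l r : Fin (n - 1), (l : ℕ) + 1 = i → (r : ℕ) = i + 1 →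
        HOq.sigmaNorm q γ c i (HOq.w q γ l r) =
          ((q ^ (-2 * γ) : ℝ) : ℂ) • HOq.w q γ i i +
            ((q ^ (-γ) : ℝ) : ℂ) • (HOq.w q γ l i + HOq.w q γ i r) + HOq.w q γ l r) ∧
      -- the Lawrence–Krammer–Bigelow representation at `(q^{-2γ}, -1)`
      ∃ ρL : Representation ℂ (BraidGroup n) (LKB.Idx n →₀ ℂ),
        (∀ (i : Fin (n - 1)) (j k : Fin n), j < k →
          ρL (braidGen i) (LKB.v ℂ j k) =
            LKB.gen ((q ^ (-2 * γ) : ℝ) : ℂ) (-1) i j k) ∧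
        Nonempty (ρ.Equiv ρL) := by
  have hs := qpow_ne_zero hq0 γ
  have hst : ((q ^ γ : ℝ) : ℂ)⁻¹ = ((q ^ (-γ) : ℝ) : ℂ) := by
    rw [← qpow_neg_inv hq0 γ, inv_inv]
  have hts : ((q ^ γ : ℝ) : ℂ) * ((q ^ (-γ) : ℝ) : ℂ) = 1 := by rw [← hst, mul_inv_cancel₀ hs]
  have h2 : ((q ^ (-2 * γ) : ℝ) : ℂ) = ((q ^ (-γ) : ℝ) : ℂ) ^ 2 :=
    (qpow_neg_nat hq0 _ _ _ (by push_cast; ring)).symm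
  have h4 : ((q ^ (-4 * γ) : ℝ) : ℂ) = ((q ^ (-γ) : ℝ) : ℂ) ^ 4 :=
    (qpow_neg_nat hq0 _ _ _ (by push_cast; ring)).symm
  have hQ : ((q ^ (-2 * γ) : ℝ) : ℂ) ≠ 0 := qpow_ne_zero hq0 _
  have hw := hoPoly_w (n := n) hq0 hq1 hγ
  have hσ : ∀ i j k : Fin (n - 1), hoPoly n γ hq0 (HOq.sigmaNorm q γ c i (HOq.w q γ j k)) =
      (HOq.qNum q γ : ℂ) • (burau (((q ^ (-γ) : ℝ) : ℂ) ^ 2) i (oForm q γ j) *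
        burau (((q ^ (-γ) : ℝ) : ℂ) ^ 2) i (oForm q γ k)) := by
    intro i j k
    rw [hoPoly_sigmaNorm hq0 hq1, hw, map_smul, map_mul]
  have hC2 : (2 * C 2⁻¹ : MvPolynomial (Fin n) ℂ) = 1 := by
    rw [← map_ofNat C 2, ← C_mul, mul_inv_cancel₀ two_ne_zero, C_1]
  have hCs : (C ((q ^ γ : ℝ) : ℂ) * C ((q ^ (-γ) : ℝ) : ℂ) : MvPolynomial (Fin n) ℂ) = 1 := by
    rw [← C_mul, hts, C_1]
  have hinj := (hoPoly n γ hq0).injective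
  have hlt : ∀ i : Fin (n - 1), lft i ≠ rgt i := lft_ne_rgt
  refine ⟨(quadRep hQ).transport (hoEquiv hq0 hq1 hγ c).symm,
    coe_transport_hoEquiv hq0 hq1 hγ c hQ h2.symm, fun i j => hinj ?_,
    ⟨wBasis hq0 hq1 hγ c, coe_wBasis hq0 hq1 hγ c, ?_,
      (quadRep hQ).transport (jkEquiv hs).symm,
      coe_transport_jkEquiv hQ hs (by rw [hst, h2]), ⟨vecBasis hs, coe_vecBasis hs⟩,
      hoJkEquiv hq0 hq1 hγ c hQ hs, fun i => (jkPoly n hs).injective ?_,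
      fun i r h hir => (jkPoly n hs).injective ?_, fun i r h hir => (jkPoly n hs).injective ?_⟩,
    fun i j k hj hk => hinj ?_, fun i => hinj ?_, fun i k hk => ⟨hinj ?_, hinj ?_⟩,
    fun i l k hl hk => ⟨hinj ?_, hinj ?_⟩, fun i l hl => ⟨hinj ?_, hinj ?_⟩,
    fun i r hr => ⟨hinj ?_, hinj ?_⟩, fun i l r hl hr => hinj ?_,
    (lkbRep hQ), lkbRep_gen hQ, ?_⟩
  · rw [hw, hw, mul_comm]
  · rw [(hoEquiv hq0 hq1 hγ c).finrank_eq, finrank_quad]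
  · rw [jkPoly_hoJkEquiv_wBasis, map_smul, jkPoly_vec hs (hlt i), hst, stepDiff]
    have hr : (rgt i : ℕ) = i + 1 := rfl
    have hl : (lft i : ℕ) = i := rfl
    simp only [MvPolynomial.smul_eq_C_mul, C_mul, C_neg, C_pow, map_ofNat, hl, hr]
    linear_combination (-(C ((q ^ (-γ) : ℝ) : ℂ) ^ ((i : ℕ) + (i + 1)) *
      (X (lft i) - X (rgt i)) ^ 2)) * hC2
  · have hri : lft r = rgt i := Fin.ext hir.symm
    have e1 : (rgt r : ℕ) = i + 2 := by simp [rgt, ← hir]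
    have e2 : (rgt i : ℕ) = i + 1 := rfl
    have e3 : (lft i : ℕ) = i := rfl
    have n1 : lft i ≠ rgt r := Fin.ne_of_val_ne (by omega)
    have n2 : rgt i ≠ rgt r := Fin.ne_of_val_ne (by omega)
    rw [jkPoly_hoJkEquiv_wBasis, map_add, map_sub, map_smul, map_smul, jkPoly_vec hs (hlt i),
      jkPoly_vec hs n1, jkPoly_vec hs n2, hst, stepDiff, stepDiff, hri, e1, e2, e3, ← hir]
    simp only [MvPolynomial.smul_eq_C_mul, C_mul, C_neg, C_pow]
    linear_combination (-(C ((q ^ (-γ) : ℝ) : ℂ) ^ ((i : ℕ) + (i + 1) + 1) *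
      ((X (lft i) - X (rgt i)) * (X (rgt i) - X (rgt r))))) * hC2 +
      C 2⁻¹ * C ((q ^ (-γ) : ℝ) : ℂ) ^ ((i : ℕ) + (i + 1) + 1) *
        (X (rgt i) - X (rgt r)) ^ 2 * hCs
  · have e1 : (rgt r : ℕ) = r + 1 := rfl
    have e2 : (rgt i : ℕ) = i + 1 := rfl
    have e3 : (lft i : ℕ) = i := rfl
    have e4 : (lft r : ℕ) = r := rfl
    have n1 : lft i ≠ rgt r := Fin.ne_of_val_ne (by omega)
    have n2 : rgt i ≠ rgt r := Fin.ne_of_val_ne (by omega)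
    have n3 : lft i ≠ lft r := Fin.ne_of_val_ne (by omega)
    have n4 : rgt i ≠ lft r := Fin.ne_of_val_ne (by omega)
    rw [jkPoly_hoJkEquiv_wBasis, map_sub, map_add, map_add, map_neg, map_smul, map_smul,
      jkPoly_vec hs n1, jkPoly_vec hs n2, jkPoly_vec hs n3, jkPoly_vec hs n4, hst, stepDiff,
      stepDiff, e1, e2, e3, e4]
    simp only [MvPolynomial.smul_eq_C_mul, C_mul, C_neg, C_pow]
    linear_combination (-(C ((q ^ (-γ) : ℝ) : ℂ) ^ ((i : ℕ) + r + 1) *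
      ((X (lft i) - X (rgt i)) * (X (lft r) - X (rgt r))))) * hC2 +
      C 2⁻¹ * C ((q ^ (-γ) : ℝ) : ℂ) ^ ((i : ℕ) + r + 1) * (X (rgt i) - X (rgt r)) ^ 2 * hCs
  · rw [hσ, hw, burau_oForm_far i j hj, burau_oForm_far i k hk]
  · rw [hσ, map_smul, hw, burau_oForm_self, h4]
    simp only [MvPolynomial.smul_eq_C_mul, C_pow]
    ring
  · rw [hσ, map_smul, hw, burau_oForm_self, burau_oForm_far i k hk, h2]
    simp only [MvPolynomial.smul_eq_C_mul, C_pow, C_neg]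
    ring
  · rw [hσ, map_smul, hw, burau_oForm_self, burau_oForm_far i k hk, h2]
    simp only [MvPolynomial.smul_eq_C_mul, C_pow, C_neg]
    ring
  · rw [hσ, map_add, map_smul, hw, hw, burau_oForm_adj i l hl, burau_oForm_far i k hk]
    simp only [MvPolynomial.smul_eq_C_mul]
    ring
  · rw [hσ, map_add, map_smul, hw, hw, burau_oForm_adj i l hl, burau_oForm_far i k hk]
    simp only [MvPolynomial.smul_eq_C_mul]
    ring
  · rw [hσ, map_smul, map_add, map_smul, hw, hw, burau_oForm_adj i l (Or.inr hl),
      burau_oForm_self, h2]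
    simp only [MvPolynomial.smul_eq_C_mul, C_pow, C_neg]
    ring
  · rw [hσ, map_add, map_add, map_smul, map_smul, hw, hw, hw, burau_oForm_adj i l (Or.inr hl), h2]
    simp only [MvPolynomial.smul_eq_C_mul, C_pow, C_mul, map_ofNat]
    ring
  · rw [hσ, map_smul, map_add, map_smul, hw, hw, burau_oForm_adj i r (Or.inl hr),
      burau_oForm_self, h2]
    simp only [MvPolynomial.smul_eq_C_mul, C_pow, C_neg]
    ring
  · rw [hσ, map_add, map_add, map_smul, map_smul, hw, hw, hw, burau_oForm_adj i r (Or.inl hr), h2]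
    simp only [MvPolynomial.smul_eq_C_mul, C_pow, C_mul, map_ofNat]
    ring
  · rw [hσ, map_add, map_add, map_smul, map_smul, map_add, hw, hw, hw, hw,
      burau_oForm_adj i l (Or.inr hl), burau_oForm_adj i r (Or.inl hr), h2]
    simp only [MvPolynomial.smul_eq_C_mul, C_pow]
    ring
  · exact ⟨((quadRep hQ).transportEquiv (hoEquiv hq0 hq1 hγ c).symm).symm.trans
      ((quadRep hQ).transportEquiv (forkBasis hQ).repr)⟩
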